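/- Let $T$ be a finite tree. Write $\ell(T)$ for its number of leaves (vertices of degree $1$) and $\iota(T)$ for its splitting irregularity number, defined as follows. A starlike tree is a tree with exactly one vertex of degree at least $3$, its central vertex. If a tree $T$ has at least two vertices of degree at least $3$, a starlike splitting of $T$ is a $4$-tuple $(S,T',v_s,v_t)$, where $S$ is a starlike tree, $v_s$ is a leaf of $S$ adjacent to its central vertex, $T'$ is a tree, $v_t$ is a vertex of $T'$, and $T$ is obtained from $S$ and $T'$ by merging $v_s$ with $v_t$. The splitting is irregular if $v_t$ has degree greater than $1$ in $T'$. Starting from $T$, split repeatedly, each time replacing the current tree by the $T'$ of the splitting, until a tree with at most one vertex of degree at least $3$ is reached; $\iota(T)$ is the number of irregular splittings used, which does not depend on the choices made. An arithmetical structure on a finite connected simple graph $G$ with adjacency matrix $A(G)$ is a pair $(\mathbf d,\mathbf r)$ of integer vectors indexed by $V(G)$, with the entries of $\mathbf d$ nonnegative and the entries of $\mathbf r$ positive with no nontrivial common factor, such that $(\operatorname{diag}(\mathbf d)-A(G))\,\mathbf r=\mathbf 0$. Its critical group is the torsion subgroup of $\mathbb Z^{V(G)}/\operatorname{im}(\operatorname{diag}(\mathbf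 d)-A(G))$. A finite abelian group has $k$ invariant factors if it is isomorphic to $\bigoplus_{i=1}^k\mathbb Z/\alpha_i\mathbb Z$ with integers $\alpha_i>1$ and $\alpha_1\mid\alpha_2\mid\cdots\mid\alpha_k$. A subdivision of $T$ is a tree obtained from $T$ by a finite (possibly empty) sequence of subdivisions of single edges. **Theorem.** Let $T$ be a finite tree, and let $\beta$ be an integer satisfying $0\le\beta\le\iota(T)$. If $\mathcal G$ is a finite abelian group with at most $\ell(T)-2-\beta$ invariant factors, then there is a subdivision $\widetilde T$ of $T$ with $\iota(\widetilde T)=\beta$ and an arithmetical structure on $\widetilde T$ whose critical group is isomorphic to $\mathcal G$. -/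

import Mathlib

universe u v

namespace SimpleGraph

/-- The degree of a vertex of a finite graph, as the cardinality of its set of neighbours. -/
noncomputable def vdeg {V : Type u} (G : SimpleGraph V) (x : V) : ℕ :=
  (G.neighborSet x).ncard

theorem vdeg_eq_degree {V : Type u} (G : SimpleGraph V) (x : V) [Fintype (G.neighborSet x)] :
    G.vdeg x = G.degree x := by
  rw [vdeg, Set.ncard_eq_toFinset_card', ← card_neighborFinset_eq_degree]
  rfl

/-- The number of leaves (vertices of degree `1`) of a finite graph. -/
noncomputable def leafNumber {V : Type u} (G : SimpleGraph V) : ℕ :=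
  {x : V | G.vdeg x = 1}.ncard

/-- The graph obtained from `G` by deleting the edge `xy` and joining both `x` and `y` to the new
vertex `none`. -/
def subdivideEdge {V : Type u} (G : SimpleGraph V) (x y : V) : SimpleGraph (Option V) where
  Adj
    | some a, some b => G.Adj a b ∧ s(a, b) ≠ s(x, y)
    | some a, none => a = x ∨ a = y
    | none, some b => b = x ∨ b = y
    | none, none => False
  symm := ⟨by
    rintro (_ | a) (_ | b) h
    · exact h
    · exact h
    · exact h
    · exact ⟨h.1.symm, by rw [Sym2.eq_swap]; exact h.2⟩⟩
  loopless := ⟨by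
    rintro (_ | a) h
    · exact h
    · exact G.loopless.irrefl a h.1⟩

/-- `G.IsSubdivision H`: up to isomorphism, the graph `H` is obtained from `G` by a finite
(possibly empty) sequence of subdivisions of single edges. -/
inductive IsSubdivision {V : Type u} (G : SimpleGraph V) :
    ∀ {W : Type v}, SimpleGraph W → Prop
  | of_iso {W : Type v} {H : SimpleGraph W} (e : G ≃g H) : IsSubdivision G H
  | step {W W' : Type v} {H : SimpleGraph W} {K : SimpleGraph W'} {x y : W}
      (h : IsSubdivision G H) (hxy : H.Adj x y) (e : H.subdivideEdge x y ≃g K) :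
      IsSubdivision G K

/-- `T` is obtained from the disjoint union of `S` and `T'` by merging the vertices `vs` of `S`
and `vt` of `T'`. -/
def IsMerging {V A B : Type u} (T : SimpleGraph V) (S : SimpleGraph A) (T' : SimpleGraph B)
    (vs : A) (vt : B) : Prop :=
  ∃ (i : A ↪ V) (j : B ↪ V),
    (∀ x : V, (∃ a, i a = x) ∨ (∃ b, j b = x)) ∧
    (∀ a b, i a = j b ↔ a = vs ∧ b = vt) ∧
    (∀ x y : V, T.Adj x y ↔
      (∃ a a', S.Adj a a' ∧ i a = x ∧ i a' = y) ∨ (∃ b b', T'.Adj b b' ∧ j b = x ∧ j b' = y))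

/-- A starlike tree: a tree with exactly one vertex of degree at least `3` (its central vertex). -/
def IsStarlike {V : Type u} (S : SimpleGraph V) : Prop :=
  S.IsTree ∧ ∃! c : V, 3 ≤ S.vdeg c

/-- `(S, T', vs, vt)` is a starlike splitting of the tree `T`, where `T` has at least two vertices
of degree at least `3`: `S` is a starlike tree, `vs` is a leaf of `S` adjacent to the central
vertex of `S`, `T'` is a tree, and `T` results from merging `vs` and `vt`. -/
structure IsStarlikeSplitting {V A B : Type u} (T : SimpleGraph V) (S : SimpleGraph A)
    (T' : SimpleGraph B) (vs : A) (vt : B) : Prop where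
  isTree : T.IsTree
  multiple : ∃ x y : V, x ≠ y ∧ 3 ≤ T.vdeg x ∧ 3 ≤ T.vdeg y
  starlike : S.IsStarlike
  isTree' : T'.IsTree
  leaf : S.vdeg vs = 1
  adj_center : ∃ c : A, 3 ≤ S.vdeg c ∧ S.Adj vs c
  merging : IsMerging T S T' vs vt

/-- `T.HasStarlikeDecomposition m`: the tree `T` has a starlike decomposition, i.e. a sequence of
starlike splittings ending with a tree with at most one vertex of degree at least `3`, in which
exactly `m` of the splittings are irregular. A splitting `(S, T', vs, vt)` is regular if `vt` has
degree `1` in `T'` and irregular if `vt` has larger degree in `T'`. -/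
inductive HasStarlikeDecomposition : ∀ {V : Type u}, SimpleGraph V → ℕ → Prop
  | base {V : Type u} {T : SimpleGraph V} (hT : T.IsTree)
      (h : ∀ x y : V, 3 ≤ T.vdeg x → 3 ≤ T.vdeg y → x = y) :
      HasStarlikeDecomposition T 0
  | regular {V A B : Type u} {T : SimpleGraph V} {S : SimpleGraph A} {T' : SimpleGraph B}
      {vs : A} {vt : B} {m : ℕ} (h : IsStarlikeSplitting T S T' vs vt) (hreg : T'.vdeg vt = 1)
      (h' : HasStarlikeDecomposition T' m) : HasStarlikeDecomposition T m
  | irregular {V A B : Type u} {T : SimpleGraph V} {S : SimpleGraph A} {T' : SimpleGraph B}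
      {vs : A} {vt : B} {m : ℕ} (h : IsStarlikeSplitting T S T' vs vt) (hirr : 1 < T'.vdeg vt)
      (h' : HasStarlikeDecomposition T' m) : HasStarlikeDecomposition T (m + 1)

/-- The splitting irregularity number of a finite tree: the number of irregular splittings in a
starlike decomposition. (Every finite tree has a starlike decomposition and all of them have the
same number of irregular splittings, so the infimum is over a one-element set.) -/
noncomputable def splittingIrregularity {V : Type u} (T : SimpleGraph V) : ℕ :=
  sInf {m : ℕ | T.HasStarlikeDecomposition m}

open Classical in
/-- The generalized Laplacian matrix `diag(d) - A(G)`. -/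
noncomputable def genLaplacian {V : Type u} [DecidableEq V] (G : SimpleGraph V) (d : V → ℤ) :
    Matrix V V ℤ :=
  Matrix.diagonal d - G.adjMatrix ℤ

/-- An arithmetical structure on a finite graph: vectors `d` with nonnegative and `r` with positive
integer entries, the entries of `r` having no nontrivial common factor, with
`(diag(d) - A(G)) r = 0`. -/
structure ArithmeticalStructure {V : Type u} [Fintype V] [DecidableEq V]
    (G : SimpleGraph V) where
  d : V → ℤ
  r : V → ℤ
  d_nonneg : ∀ x, 0 ≤ d x
  r_pos : ∀ x, 0 < r x
  r_primitive : ∀ k : ℤ, (∀ x, k ∣ r x) → IsUnit k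
  laplacian_mulVec : (G.genLaplacian d).mulVec r = 0

/-- The critical group of an arithmetical structure: the torsion part of the cokernel of the
generalized Laplacian matrix, acting on the integer vectors indexed by the vertices. -/
abbrev ArithmeticalStructure.CriticalGroup {V : Type u} [Fintype V] [DecidableEq V]
    {G : SimpleGraph V} (A : G.ArithmeticalStructure) : Type u :=
  Submodule.torsion ℤ ((V → ℤ) ⧸ LinearMap.range (G.genLaplacian A.d).mulVecLin)

end SimpleGraph

/-- The abelian group `A` has exactly `k` invariant factors: it is isomorphic to the direct sum of
the groups `ℤ/αᵢℤ` for integers `αᵢ > 1`, where `i` runs through `k` indices and `αᵢ` divides `αⱼ`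
for `i ≤ j`. -/
def HasInvariantFactorCount (A : Type u) [AddCommGroup A] (k : ℕ) : Prop :=
  ∃ α : Fin k → ℕ, (∀ i, 1 < α i) ∧ (∀ i j, i ≤ j → α i ∣ α j) ∧
    Nonempty (A ≃+ ((i : Fin k) → ZMod (α i)))

/-! ### Sparse edge sets. -/

namespace SimpleGraph

/-! The splitting irregularity number is the largest size of a sparse edge set. In a starlike
splitting, the only edge of a sparse set that can lie outside `T'` joins the centre of `S` to the
glueing vertex. After a regular splitting the glueing vertex has degree 2 in `T` and no sparse set
touches it. After an irregular one its capacity in `T` is one more than in `T'`, so the maximum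
grows by exactly one (`hasMaxSparse_of_decomposition`). Subsets of sparse sets are sparse, so there
is a sparse set `M` with exactly `β` edges.

Root the tree at a leaf `ρ` and subdivide every edge outside `M` except the one at `ρ`. The edges
with both ends of degree at least 3 are now exactly those of `M`, so the new irregularity is `β`
(`IsParent.hasMaxSparse_subdiv`).

The subdivided tree consists of legs, one from each `x ≠ ρ` up to its parent. Sparsity leaves every
interior `x ≠ ρ` a child `s x` whose edge is not in `M`; its leg is special. Of the other subdivided
legs at least `ℓ(T) - 2 - β` exist (`IsParent.leafNumber_le`), and each can carry one prescribed
cyclic factor `ℤ/α`. Such a leg has one new vertex, and its parent end has `α` times the value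
there. The special leg of `x` is long: its multiplicities come from a division algorithm with
negative remainders (`exists_division_sequence`) and are chosen to balance the equation at `x`
(`exists_legData`).

The critical group is read off from harmonic functions, that is, solutions of the Laplacian
relations with values in an arbitrary abelian group; the cokernel carries the universal one. With
the leg multiplicities fixed, a harmonic function amounts to its value at `ρ` together with one
element killed by `α` for each leg carrying a factor: such data propagate from the root to a
harmonic function (`LegData.IsSolution.isHarmonic`), and every harmonic function arises so
(`LegData.isSolution_legValue`, `LegData.extend_legValue`). Hence the cokernel is `ℤ ⊕ ⨁ ℤ/α` and
its torsion is the required group. The integer solution with value 1 at `ρ` is the vector `r`. -/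

/-- A set of edges of `T` containing at most `deg v - 2` edges at each vertex `v`. -/
def IsSparse {V : Type u} (T : SimpleGraph V) (M : Set (Sym2 V)) : Prop :=
  M ⊆ T.edgeSet ∧ ∀ v, {e ∈ M | v ∈ e}.ncard ≤ T.vdeg v - 2

/-- The largest size of a sparse set of edges of `T` is `m`. -/
def HasMaxSparse {V : Type u} (T : SimpleGraph V) (m : ℕ) : Prop :=
  (∃ M, T.IsSparse M ∧ M.ncard = m) ∧ ∀ M, T.IsSparse M → M.ncard ≤ m

/-- The truncated subtraction matters here: vertices of degree at most 2 have capacity 0. -/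
theorem IsSparse.three_le_vdeg {V : Type u} [Finite V] {T : SimpleGraph V} {M : Set (Sym2 V)}
    (h : T.IsSparse M) {e : Sym2 V} (he : e ∈ M) {v : V} (hv : v ∈ e) : 3 ≤ T.vdeg v := by
  have h1 := h.2 v
  have h2 : 0 < {e ∈ M | v ∈ e}.ncard :=
    (Set.ncard_pos (Set.toFinite _)).2 ⟨e, he, hv⟩
  omega

theorem IsSparse.mono {V : Type u} [Finite V] {T : SimpleGraph V} {M M' : Set (Sym2 V)}
    (h : T.IsSparse M) (hM : M' ⊆ M) : T.IsSparse M' :=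
  by
  refine ⟨hM.trans h.1, fun v => le_trans (Set.ncard_le_ncard ?_) (h.2 v)⟩
  exact fun _ he => ⟨hM he.1, he.2⟩

theorem HasMaxSparse.unique {V : Type u} {T : SimpleGraph V} {m n : ℕ}
    (hm : T.HasMaxSparse m) (hn : T.HasMaxSparse n) : m = n := by
  obtain ⟨⟨M, hM, rfl⟩, h1⟩ := hm
  obtain ⟨⟨N, hN, rfl⟩, h2⟩ := hn
  exact le_antisymm (h2 M hM) (h1 N hN)

/-! ### Sparse sets under merging of trees. -/

section Merging

variable {V A B : Type u} {T : SimpleGraph V} {S : SimpleGraph A} {T' : SimpleGraph B}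
  {vs : A} {vt : B} {i : A ↪ V} {j : B ↪ V}

/-- The conditions on the two embeddings occurring in a merging. -/
structure IsMergingVia (T : SimpleGraph V) (S : SimpleGraph A) (T' : SimpleGraph B)
    (vs : A) (vt : B) (i : A ↪ V) (j : B ↪ V) : Prop where
  cover : ∀ x : V, (∃ a, i a = x) ∨ (∃ b, j b = x)
  eq_iff : ∀ a b, i a = j b ↔ a = vs ∧ b = vt
  adj_iff : ∀ x y : V, T.Adj x y ↔
      (∃ a a', S.Adj a a' ∧ i a = x ∧ i a' = y) ∨ (∃ b b', T'.Adj b b' ∧ j b = x ∧ j b' = y)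

theorem ncard_incident_image (M : Set (Sym2 B)) (b : B) :
    {e ∈ Sym2.map j '' M | j b ∈ e}.ncard = {e ∈ M | b ∈ e}.ncard := by
  rw [← Set.ncard_image_of_injective {e ∈ M | b ∈ e} (Sym2.map.injective j.injective)]
  congr 1
  ext e
  constructor
  · rintro ⟨⟨e, he, rfl⟩, hb⟩
    obtain ⟨b', hb', hj⟩ := Sym2.mem_map.1 hb
    exact ⟨e, ⟨he, j.injective hj ▸ hb'⟩, rfl⟩
  · rintro ⟨e, ⟨he, hb⟩, rfl⟩
    exact ⟨⟨e, he, rfl⟩, Sym2.mem_map.2 ⟨b, hb, rfl⟩⟩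

theorem sparse_inter_ncard_le [Finite V] {M : Set (Sym2 V)} (b : B) :
    {e ∈ {e : Sym2 B | e.map j ∈ M} | b ∈ e}.ncard ≤ {e ∈ M | j b ∈ e}.ncard := by
  rw [← Set.ncard_image_of_injective _ (Sym2.map.injective j.injective)]
  refine Set.ncard_le_ncard ?_
  rintro _ ⟨e, ⟨he, hb⟩, rfl⟩
  exact ⟨he, Sym2.mem_map.2 ⟨b, hb, rfl⟩⟩

namespace IsMergingVia

variable (h : IsMergingVia T S T' vs vt i j)
include h

theorem glue : i vs = j vt := (h.eq_iff vs vt).2 ⟨rfl, rfl⟩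

theorem neighborSet_left {a : A} (ha : a ≠ vs) : T.neighborSet (i a) = i '' S.neighborSet a := by
  ext y
  simp only [mem_neighborSet, h.adj_iff, Set.mem_image]
  constructor
  · rintro (⟨a1, a2, h1, h2, h3⟩ | ⟨b1, b2, h1, h2, h3⟩)
    · rw [i.injective h2] at h1
      exact ⟨a2, h1, h3⟩
    · exact absurd ((h.eq_iff _ _).1 h2.symm).1 ha
  · rintro ⟨a2, h1, h3⟩
    exact Or.inl ⟨a, a2, h1, rfl, h3⟩

theorem neighborSet_right {b : B} (hb : b ≠ vt) :
    T.neighborSet (j b) = j '' T'.neighborSet b := by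
  ext y
  simp only [mem_neighborSet, h.adj_iff, Set.mem_image]
  constructor
  · rintro (⟨a1, a2, h1, h2, h3⟩ | ⟨b1, b2, h1, h2, h3⟩)
    · exact absurd ((h.eq_iff _ _).1 h2).2 hb
    · rw [j.injective h2] at h1
      exact ⟨b2, h1, h3⟩
  · rintro ⟨a2, h1, h3⟩
    exact Or.inr ⟨b, a2, h1, rfl, h3⟩

theorem neighborSet_glue :
    T.neighborSet (j vt) = i '' S.neighborSet vs ∪ j '' T'.neighborSet vt := by
  ext y
  simp only [mem_neighborSet, h.adj_iff, Set.mem_image, Set.mem_union]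
  constructor
  · rintro (⟨a1, a2, h1, h2, h3⟩ | ⟨b1, b2, h1, h2, h3⟩)
    · rw [((h.eq_iff _ _).1 h2).1] at h1
      exact Or.inl ⟨a2, h1, h3⟩
    · rw [j.injective h2] at h1
      exact Or.inr ⟨b2, h1, h3⟩
  · rintro (⟨a2, h1, h3⟩ | ⟨a2, h1, h3⟩)
    · exact Or.inl ⟨vs, a2, h1, h.glue, h3⟩
    · exact Or.inr ⟨vt, a2, h1, rfl, h3⟩

theorem vdeg_left {a : A} (ha : a ≠ vs) : T.vdeg (i a) = S.vdeg a := by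
  rw [vdeg, h.neighborSet_left ha, Set.ncard_image_of_injective _ i.injective, vdeg]

theorem vdeg_right {b : B} (hb : b ≠ vt) : T.vdeg (j b) = T'.vdeg b := by
  rw [vdeg, h.neighborSet_right hb, Set.ncard_image_of_injective _ j.injective, vdeg]

theorem vdeg_glue [Finite V] : T.vdeg (j vt) = S.vdeg vs + T'.vdeg vt := by
  have := Finite.of_injective i i.injective
  have := Finite.of_injective j j.injective
  rw [vdeg, h.neighborSet_glue, Set.ncard_union_eq,
    Set.ncard_image_of_injective _ j.injective, Set.ncard_image_of_injective _ i.injective,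
    vdeg, vdeg]
  rw [Set.disjoint_left]
  rintro _ ⟨a, ha, rfl⟩ ⟨b, hb, hab⟩
  rw [((h.eq_iff _ _).1 hab.symm).1] at ha
  exact ha.ne rfl

/-- An edge of `S` with both ends in the image of `T'` would be a loop at `vs`. -/
theorem map_mem_edgeSet {e : Sym2 B} : e.map j ∈ T.edgeSet ↔ e ∈ T'.edgeSet := by
  induction e with | _ b b'
  simp only [Sym2.map_mk, mem_edgeSet, h.adj_iff]
  constructor
  · rintro (⟨a1, a2, h1, h2, h3⟩ | ⟨b1, b2, h1, h2, h3⟩)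
    · rw [((h.eq_iff _ _).1 h2).1, ((h.eq_iff _ _).1 h3).1] at h1
      exact absurd rfl h1.ne
    · rwa [j.injective h2, j.injective h3] at h1
  · exact fun hb => Or.inr ⟨b, b', hb, rfl, rfl⟩

/-- The sparse sets of the larger tree consist of edges of the smaller tree and possibly the edge
joining the centre to the glueing vertex. -/
theorem mem_sparse [Finite V] {c : A} (hc : ∀ a, 3 ≤ S.vdeg a → a = c)
    {M : Set (Sym2 V)} (hM : T.IsSparse M) {e : Sym2 V} (he : e ∈ M) :
    e = s(i c, j vt) ∨ ∃ e' ∈ T'.edgeSet, e'.map j = e := by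
  have hhigh := fun v => hM.three_le_vdeg (v := v) he
  have hT := hM.1 he
  induction e with | _ x y
  have hx := hhigh x (by simp)
  have hy := hhigh y (by simp)
  rw [mem_edgeSet, h.adj_iff] at hT
  rcases hT with ⟨a1, a2, h1, rfl, rfl⟩ | ⟨b1, b2, h1, rfl, rfl⟩
  · left
    have key : ∀ a, 3 ≤ T.vdeg (i a) → a = vs ∨ a = c := fun a ha => by
      by_cases hav : a = vs
      · exact Or.inl hav
      · rw [h.vdeg_left hav] at ha
        exact Or.inr (hc a ha)
    rw [← h.glue]
    rcases key _ hx with rfl | rfl <;> rcases key _ hy with rfl | rfl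
    · exact absurd rfl h1.ne
    · exact Sym2.eq_swap
    · rfl
    · exact absurd rfl h1.ne
  · exact Or.inr ⟨s(b1, b2), h1, rfl⟩

theorem incident_image_left (M : Set (Sym2 B)) {a : A} (ha : a ≠ vs) :
    {e ∈ Sym2.map j '' M | i a ∈ e} = ∅ := by
  ext e
  simp only [Set.mem_ofPred_eq, Set.mem_empty_iff_false, iff_false]
  rintro ⟨⟨e, he, rfl⟩, hb⟩
  obtain ⟨b', hb', hj⟩ := Sym2.mem_map.1 hb
  exact ha ((h.eq_iff _ _).1 hj.symm).1

theorem isSparse_image [Finite V] (hvs : S.vdeg vs = 1) {M : Set (Sym2 B)}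
    (hM : T'.IsSparse M) : T.IsSparse (Sym2.map j '' M) := by
  refine ⟨?_, fun v => ?_⟩
  · rintro _ ⟨e, he, rfl⟩
    exact h.map_mem_edgeSet.2 (hM.1 he)
  · by_cases hv : ∃ b, j b = v
    · obtain ⟨b, rfl⟩ := hv
      rw [ncard_incident_image]
      refine (hM.2 b).trans ?_
      by_cases hb : b = vt
      · subst hb
        rw [h.vdeg_glue]
        omega
      · rw [h.vdeg_right hb]
    · obtain ⟨a, rfl⟩ := (h.cover v).resolve_right hv
      have ha : a ≠ vs := by
        rintro rfl
        exact hv ⟨vt, h.glue.symm⟩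
      rw [h.incident_image_left M ha, Set.ncard_empty]
      exact Nat.zero_le _

/-- Both ends of the new edge have room for it. No edge of the image meets the centre, whose
capacity is at least 1. At the glueing vertex the degree exceeds that in `T'` by one, and since the
latter is at least 2 the truncated capacity really rises. -/
theorem isSparse_insert [Finite V] (hvs : S.vdeg vs = 1) {c : A} (hc : 3 ≤ S.vdeg c)
    (hadj : S.Adj vs c) (hirr : 1 < T'.vdeg vt) {M : Set (Sym2 B)} (hM : T'.IsSparse M) :
    T.IsSparse (insert s(i c, j vt) (Sym2.map j '' M)) := by
  have hcv : c ≠ vs := hadj.ne'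
  have key : ∀ v, {e ∈ insert s(i c, j vt) (Sym2.map j '' M) | v ∈ e} ⊆
      {e | e = s(i c, j vt) ∧ v ∈ e} ∪ {e ∈ Sym2.map j '' M | v ∈ e} := by
    rintro v e ⟨rfl | he, hv⟩
    · exact Or.inl ⟨rfl, hv⟩
    · exact Or.inr ⟨he, hv⟩
  have hle : ∀ v, {e ∈ insert s(i c, j vt) (Sym2.map j '' M) | v ∈ e}.ncard ≤
      {e | e = s(i c, j vt) ∧ v ∈ e}.ncard + {e ∈ Sym2.map j '' M | v ∈ e}.ncard := fun v =>
    (Set.ncard_le_ncard (key v)).trans (Set.ncard_union_le _ _)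
  have hone : ∀ v, {e | e = s(i c, j vt) ∧ v ∈ e}.ncard ≤ 1 := fun v => by
    rw [← Set.ncard_singleton s(i c, j vt)]
    exact Set.ncard_le_ncard (fun e he => he.1)
  have hzero : ∀ v, v ≠ i c → v ≠ j vt → {e | e = s(i c, j vt) ∧ v ∈ e}.ncard = 0 := by
    intro v h1 h2
    rw [Set.ncard_eq_zero]
    ext e
    simp only [Set.mem_ofPred_eq, Set.mem_empty_iff_false, iff_false]
    rintro ⟨rfl, hv⟩
    rcases Sym2.mem_iff.1 hv with hv | hv
    · exact h1 hv
    · exact h2 hv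
  have hS := h.isSparse_image hvs hM
  refine ⟨?_, fun v => (hle v).trans ?_⟩
  · rintro e (rfl | he)
    · rw [mem_edgeSet, h.adj_iff]
      exact Or.inl ⟨c, vs, hadj.symm, rfl, h.glue⟩
    · exact hS.1 he
  · by_cases h1 : v = i c
    · subst h1
      rw [h.incident_image_left M hcv, Set.ncard_empty, h.vdeg_left hcv]
      have := hone (i c)
      omega
    · by_cases h2 : v = j vt
      · subst h2
        rw [ncard_incident_image, h.vdeg_glue, hvs]
        have := hone (j vt)
        have := hM.2 vt
        omega
      · rw [hzero v h1 h2, zero_add]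
        exact hS.2 v

theorem notMem_image {c : A} (hcv : c ≠ vs) (M : Set (Sym2 B)) :
    s(i c, j vt) ∉ Sym2.map j '' M := by
  rintro ⟨e, -, he⟩
  have : i c ∈ e.map j := by rw [he]; exact Sym2.mem_mk_left _ _
  obtain ⟨b, -, hb⟩ := Sym2.mem_map.1 this
  exact hcv ((h.eq_iff _ _).1 hb.symm).1

/-- Restricting a sparse set to the smaller tree, the capacity is exceeded at most by one at the
glueing vertex. -/
theorem isSparse_restrict [Finite V] {M : Set (Sym2 V)}
    (hM : T.IsSparse M) {M' : Set (Sym2 B)} (hsub : ∀ e ∈ M', e.map j ∈ M)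
    (hvt : {e ∈ M' | vt ∈ e}.ncard ≤ T'.vdeg vt - 2) : T'.IsSparse M' := by
  have := Finite.of_injective j j.injective
  refine ⟨fun e he => h.map_mem_edgeSet.1 (hM.1 (hsub e he)), fun b => ?_⟩
  by_cases hb : b = vt
  · subst hb
    exact hvt
  · rw [← h.vdeg_right hb]
    refine le_trans ?_ ((sparse_inter_ncard_le b).trans (hM.2 _))
    exact Set.ncard_le_ncard (fun e he => ⟨hsub e he.1, he.2⟩)

end IsMergingVia

end Merging

/-- The right-hand notion does not mention the decomposition, so this also yields independence of
the choices made. -/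
theorem hasMaxSparse_of_decomposition {V : Type u} [Finite V] {T : SimpleGraph V} {m : ℕ}
    (h : T.HasStarlikeDecomposition m) : T.HasMaxSparse m := by
  rename_i hV
  revert hV
  induction h with
  | @base V T hT h =>
    intro hV
    refine ⟨⟨∅, ⟨Set.empty_subset _, fun v => ?_⟩, Set.ncard_empty _⟩, fun M hM => ?_⟩
    · simp
    · rw [nonpos_iff_eq_zero, Set.ncard_eq_zero, Set.eq_empty_iff_forall_notMem]
      intro e he
      have hhigh := fun v => hM.three_le_vdeg (v := v) he
      have hT := hM.1 he
      induction e with | _ x y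
      exact ((mem_edgeSet T).1 hT).ne (h x y (hhigh x (by simp)) (hhigh y (by simp)))
  | @regular V A B T S T' vs vt m h hreg h' ih =>
    intro hV
    obtain ⟨i, j, h1, h2, h3⟩ := h.merging
    have hm : IsMergingVia T S T' vs vt i j := ⟨h1, h2, h3⟩
    have := Finite.of_injective j j.injective
    obtain ⟨⟨M, hM, hcard⟩, hmax⟩ := ih
    obtain ⟨c, hc, huniq⟩ := h.starlike.2
    have hinj := Sym2.map.injective j.injective
    refine ⟨⟨Sym2.map j '' M, hm.isSparse_image h.leaf hM, ?_⟩, fun N hN => ?_⟩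
    · rw [Set.ncard_image_of_injective _ hinj, hcard]
    · have hlow : ∀ e ∈ N, j vt ∉ e := fun e he hv => by
        have := hN.three_le_vdeg he hv
        rw [hm.vdeg_glue, hreg, h.leaf] at this
        omega
      have hN' : T'.IsSparse {e | e.map j ∈ N} := by
        refine hm.isSparse_restrict hN (fun e he => he) ?_
        rw [(Set.ncard_eq_zero (Set.toFinite _)).2]
        · exact Nat.zero_le _
        · rw [Set.eq_empty_iff_forall_notMem]
          rintro e ⟨he, hv⟩
          exact hlow _ he (Sym2.mem_map.2 ⟨vt, hv, rfl⟩)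
      refine le_trans ?_ (hmax _ hN')
      rw [← Set.ncard_image_of_injective _ hinj]
      refine Set.ncard_le_ncard ?_
      intro e he
      rcases hm.mem_sparse huniq hN he with rfl | ⟨e', -, rfl⟩
      · exact absurd (Sym2.mem_mk_right _ _) (hlow _ he)
      · exact ⟨e', he, rfl⟩
  | @irregular V A B T S T' vs vt m h hirr h' ih =>
    intro hV
    obtain ⟨i, j, h1, h2, h3⟩ := h.merging
    have hm : IsMergingVia T S T' vs vt i j := ⟨h1, h2, h3⟩
    have := Finite.of_injective j j.injective
    obtain ⟨⟨M, hM, hcard⟩, hmax⟩ := ih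
    obtain ⟨c, hc, huniq⟩ := h.starlike.2
    have hadj : S.Adj vs c := by
      obtain ⟨c', h1, h2⟩ := h.adj_center
      rwa [huniq c' h1] at h2
    have hinj := Sym2.map.injective j.injective
    refine ⟨⟨_, hm.isSparse_insert h.leaf hc hadj hirr hM, ?_⟩, fun N hN => ?_⟩
    · rw [Set.ncard_insert_of_notMem (hm.notMem_image hadj.ne' M),
        Set.ncard_image_of_injective _ hinj, hcard]
    · set N' : Set (Sym2 B) := {e | e.map j ∈ N} with hN'
      have hcover : N ⊆ insert s(i c, j vt) (Sym2.map j '' N') := by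
        intro e he
        rcases hm.mem_sparse huniq hN he with rfl | ⟨e', -, rfl⟩
        · exact Or.inl rfl
        · exact Or.inr ⟨e', he, rfl⟩
      have hvt := hN.2 (j vt)
      rw [hm.vdeg_glue, h.leaf] at hvt
      by_cases he0 : s(i c, j vt) ∈ N
      -- The edge at the centre uses up the extra unit of capacity at the glueing vertex, so the
      -- rest of `N` is sparse in `T'`.
      · have hS : T'.IsSparse N' := by
          refine hm.isSparse_restrict hN (fun e he => he) ?_
          have : {e ∈ N' | vt ∈ e}.ncard + 1 ≤ {e ∈ N | j vt ∈ e}.ncard := by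
            rw [← Set.ncard_image_of_injective _ hinj, ← Set.ncard_insert_of_notMem
              (hm.notMem_image hadj.ne' _)]
            refine Set.ncard_le_ncard ?_
            rintro e (rfl | ⟨e, ⟨he, hv⟩, rfl⟩)
            · exact ⟨he0, Sym2.mem_mk_right _ _⟩
            · exact ⟨he, Sym2.mem_map.2 ⟨vt, hv, rfl⟩⟩
          omega
        have := hmax _ hS
        have h2 := (Set.ncard_le_ncard hcover).trans (Set.ncard_insert_le _ _)
        rw [Set.ncard_image_of_injective _ hinj] at h2
        omega
      · have hN2 : N.ncard ≤ N'.ncard := by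
          rw [← Set.ncard_image_of_injective _ hinj]
          refine Set.ncard_le_ncard ?_
          intro e he
          rcases hcover he with rfl | h
          · exact absurd he he0
          · exact h
        have hle : {e ∈ N' | vt ∈ e}.ncard ≤ {e ∈ N | j vt ∈ e}.ncard :=
          sparse_inter_ncard_le vt
        -- Without that edge, `N'` may exceed the capacity of `T'` at `vt` by one; discarding one
        -- edge at `vt` repairs this and costs the one unit that is available.
        by_cases hemp : {e ∈ N' | vt ∈ e} = ∅
        · have := hmax N' (hm.isSparse_restrict hN (fun e he => he) (by simp [hemp]))
          omega
        · obtain ⟨e, he, hev⟩ := Set.nonempty_iff_ne_empty.2 hemp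
          have hS : T'.IsSparse (N' \ {e}) := by
            refine hm.isSparse_restrict hN (fun e he => he.1) ?_
            have : {e' ∈ N' \ {e} | vt ∈ e'} = {e ∈ N' | vt ∈ e} \ {e} := by
              ext e'
              simp only [Set.mem_ofPred_eq, Set.mem_sdiff, Set.mem_singleton_iff]
              tauto
            rw [this, Set.ncard_sdiff_singleton_of_mem (show e ∈ {e ∈ N' | vt ∈ e} from ⟨he, hev⟩)]
            omega
          have := hmax _ hS
          rw [Set.ncard_sdiff_singleton_of_mem he] at this
          omega

theorem exists_sparse_splittingIrregularity {V : Type u} [Finite V] (T : SimpleGraph V) :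
    ∃ M, T.IsSparse M ∧ M.ncard = T.splittingIrregularity := by
  rcases Set.eq_empty_or_nonempty {m : ℕ | T.HasStarlikeDecomposition m} with h | h
  · refine ⟨∅, ⟨Set.empty_subset _, fun v => by simp⟩, ?_⟩
    rw [splittingIrregularity, h, Nat.sInf_empty, Set.ncard_empty]
  · exact (hasMaxSparse_of_decomposition (Nat.sInf_mem h)).1

/-! ### Rooted trees as parent functions. -/

/-- `p` is the parent function of a rooted tree with root `ρ`; the rank function `h` decreases
along `p`. -/
structure IsParent {V : Type u} (p : V → V) (ρ : V) (h : V → ℕ) : Prop where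
  root : p ρ = ρ
  lt : ∀ x, x ≠ ρ → h (p x) < h x

/-- The graph joining every vertex to its parent. -/
def parentGraph {V : Type u} (p : V → V) : SimpleGraph V := fromRel fun x y => p x = y

namespace IsParent

variable {V : Type u} {p : V → V} {ρ : V} {h : V → ℕ} (hp : IsParent p ρ h)
include hp

theorem ne_self {x : V} (hx : x ≠ ρ) : p x ≠ x := fun e => by
  have := hp.lt x hx
  rw [e] at this
  exact lt_irrefl _ this

theorem induction {P : V → Prop} (root : P ρ) (step : ∀ x, x ≠ ρ → P (p x) → P x) (x : V) :
    P x := by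
  induction hn : h x using Nat.strong_induction_on generalizing x with
  | _ n ih =>
    by_cases hx : x = ρ
    · exact hx ▸ root
    · exact step x hx (ih _ (hn ▸ hp.lt x hx) _ rfl)

/-- Induction from the leaves to the root. -/
theorem induction_up [Finite V] {P : V → Prop}
    (step : ∀ x, (∀ y, y ≠ ρ → p y = x → P y) → P x) (x : V) : P x := by
  obtain ⟨N, hN⟩ := (Set.finite_range h).bddAbove
  have hN : ∀ x, h x ≤ N := fun x => hN ⟨x, rfl⟩
  induction hn : N - h x using Nat.strong_induction_on generalizing x with
  | _ n ih =>
    refine step x fun y hy hyx => ih _ ?_ y rfl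
    have := hp.lt y hy
    have := hN y
    rw [hyx] at *
    omega

theorem adj_iff {x y : V} :
    (parentGraph p).Adj x y ↔ (x ≠ ρ ∧ p x = y) ∨ (y ≠ ρ ∧ p y = x) := by
  rw [parentGraph, fromRel_adj]
  constructor
  · rintro ⟨hne, rfl | rfl⟩
    · exact Or.inl ⟨fun e => hne (by rw [e, hp.root]), rfl⟩
    · exact Or.inr ⟨fun e => hne (by rw [e, hp.root]), rfl⟩
  · rintro (⟨hx, rfl⟩ | ⟨hy, rfl⟩)
    · exact ⟨(hp.ne_self hx).symm, Or.inl rfl⟩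
    · exact ⟨hp.ne_self hy, Or.inr rfl⟩

theorem adj_parent {x : V} (hx : x ≠ ρ) : (parentGraph p).Adj x (p x) :=
  hp.adj_iff.2 (Or.inl ⟨hx, rfl⟩)

theorem neighborSet_root : (parentGraph p).neighborSet ρ = {y | y ≠ ρ ∧ p y = ρ} := by
  ext y
  rw [mem_neighborSet, hp.adj_iff]
  simp

theorem neighborSet_of_ne {x : V} (hx : x ≠ ρ) :
    (parentGraph p).neighborSet x = insert (p x) {y | y ≠ ρ ∧ p y = x} := by
  ext y
  rw [mem_neighborSet, hp.adj_iff, Set.mem_insert_iff, eq_comm (a := y)]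
  simp [hx]

theorem parent_notMem_children {x : V} (hx : x ≠ ρ) : p x ∉ {y | y ≠ ρ ∧ p y = x} := by
  rintro ⟨h1, h2⟩
  have h3 := hp.lt x hx
  have h4 := hp.lt _ h1
  rw [h2] at h4
  omega

theorem vdeg_root : (parentGraph p).vdeg ρ = {y | y ≠ ρ ∧ p y = ρ}.ncard := by
  rw [vdeg, hp.neighborSet_root]

theorem vdeg_of_ne [Finite V] {x : V} (hx : x ≠ ρ) :
    (parentGraph p).vdeg x = {y | y ≠ ρ ∧ p y = x}.ncard + 1 := by
  rw [vdeg, hp.neighborSet_of_ne hx, Set.ncard_insert_of_notMem (hp.parent_notMem_children hx)]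

theorem connected : (parentGraph p).Connected := by
  have key : ∀ x, (parentGraph p).Reachable ρ x :=
    hp.induction (Reachable.refl _) fun x hx ih => ih.trans (hp.adj_parent hx).symm.reachable
  exact { preconnected := fun x y => (key x).symm.trans (key y), nonempty := ⟨ρ⟩ }

/-- Edges correspond to non-root vertices: if two of these were each other's parent, the rank would
decrease both ways. -/
theorem injOn_edge : Set.InjOn (fun x => s(x, p x)) {x | x ≠ ρ} := by
  intro x hx y hy hxy
  rcases Sym2.eq_iff.1 hxy with ⟨h1, -⟩ | ⟨h1, h2⟩
  · exact h1
  · have h3 := hp.lt x hx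
    have h4 := hp.lt y hy
    rw [h2] at h3
    rw [← h1] at h4
    omega

theorem edgeSet_eq : (parentGraph p).edgeSet = (fun x => s(x, p x)) '' {x | x ≠ ρ} := by
  ext e
  induction e with | _ x y
  rw [mem_edgeSet, hp.adj_iff]
  constructor
  · rintro (⟨hx, rfl⟩ | ⟨hy, rfl⟩)
    · exact ⟨x, hx, rfl⟩
    · exact ⟨y, hy, Sym2.eq_swap⟩
  · rintro ⟨z, hz, he⟩
    rcases Sym2.eq_iff.1 he with ⟨rfl, h1⟩ | ⟨rfl, h1⟩
    · exact Or.inl ⟨hz, h1⟩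
    · exact Or.inr ⟨hz, h1⟩

theorem isTree [Finite V] : (parentGraph p).IsTree := by
  rw [isTree_iff_connected_and_card]
  refine ⟨hp.connected, ?_⟩
  rw [Nat.card_coe_set_eq, hp.edgeSet_eq, hp.injOn_edge.ncard_image]
  have := Set.ncard_add_ncard_compl {x : V | x ≠ ρ}
  have h2 : {x : V | x ≠ ρ}ᶜ = {ρ} := by ext; simp
  rw [h2, Set.ncard_singleton] at this
  exact this

theorem sum_neighbors [Fintype V] [DecidableEq V] {P : Type v} [AddCommMonoid P] (X : V → P)
    (x : V) [DecidablePred ((parentGraph p).Adj x)] :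
    ∑ y with (parentGraph p).Adj x y, X y =
      (if x = ρ then 0 else X (p x)) + ∑ y with y ≠ ρ ∧ p y = x, X y := by
  by_cases hx : x = ρ
  · subst hx
    rw [if_pos rfl, zero_add]
    congr 1
    ext y
    simp [hp.adj_iff]
  · rw [if_neg hx, ← Finset.sum_insert (by simpa using hp.parent_notMem_children hx)]
    congr 1
    ext y
    simp [hp.adj_iff, hx, eq_comm]

/-- Recursion along the parent function. -/
theorem exists_rec {P : Type v} (a : P) (G : V → P → P) :
    ∃ τ : V → P, τ ρ = a ∧ ∀ x, x ≠ ρ → τ x = G x (τ (p x)) := by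
  classical
  let τ : V → P := (measure h).wf.fix fun x IH =>
    if hx : x = ρ then a else G x (IH (p x) (hp.lt x hx))
  refine ⟨τ, ?_, fun x hx => ?_⟩
  · simp only [τ]
    rw [WellFounded.fix_eq, dif_pos rfl]
  · simp only [τ]
    rw [WellFounded.fix_eq, dif_neg hx]

end IsParent

theorem Connected.exists_adj_dist_lt {V : Type u} {T : SimpleGraph V} (hT : T.Connected)
    {ρ x : V} (hx : x ≠ ρ) : ∃ y, T.Adj x y ∧ T.dist ρ y < T.dist ρ x := by
  obtain ⟨w, hw⟩ := hT.exists_walk_length_eq_dist x ρ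
  cases w with
  | nil => exact absurd rfl hx
  | @cons _ y _ hxy w =>
    refine ⟨y, hxy, ?_⟩
    have := dist_le w
    rw [dist_comm (u := ρ), dist_comm (u := ρ), ← hw, Walk.length_cons]
    omega

theorem IsTree.exists_isParent {V : Type u} {T : SimpleGraph V} (hT : T.IsTree)
    (ρ : V) : ∃ p h, IsParent p ρ h ∧ T = parentGraph p := by
  classical
  have H := fun (x : V) (hx : x ≠ ρ) => hT.connected.exists_adj_dist_lt hx
  choose! q hq hlt using H
  have hp : IsParent (fun x => if x = ρ then ρ else q x) ρ (T.dist ρ) :=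
    ⟨if_pos rfl, fun x hx => by simpa only [if_neg hx] using hlt x hx⟩
  refine ⟨_, _, hp, ?_⟩
  have hle : parentGraph (fun x => if x = ρ then ρ else q x) ≤ T := by
    intro x y hxy
    rcases hp.adj_iff.1 hxy with ⟨hx, rfl⟩ | ⟨hy, rfl⟩
    · simpa only [if_neg hx] using hq x hx
    · simpa only [if_neg hy] using (hq y hy).symm
  -- A tree is minimal among connected graphs, so the connected subgraph of parent edges is
  -- everything.
  exact le_antisymm ((isTree_iff_minimal_connected.1 hT).2 hp.connected hle) hle

/-! ### Existence of starlike decompositions. -/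

/-- The vertices having `c` as an iterated parent, `c` included. -/
def descendants {V : Type u} (p : V → V) (c : V) : Set V := {z | ∃ n, p^[n] z = c}

namespace IsParent

variable {V : Type u} {p : V → V} {ρ : V} {h : V → ℕ} (hp : IsParent p ρ h)

theorem self_mem_descendants (p : V → V) (c : V) : c ∈ descendants p c := ⟨0, rfl⟩

theorem mem_descendants_of_parent {c z : V} (hz : p z ∈ descendants p c) :
    z ∈ descendants p c := by
  obtain ⟨n, hn⟩ := hz
  exact ⟨n + 1, hn⟩

theorem parent_mem_descendants {c z : V} (hz : z ∈ descendants p c) (hne : z ≠ c) :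
    p z ∈ descendants p c := by
  obtain ⟨n, hn⟩ := hz
  cases n with
  | zero => exact absurd hn hne
  | succ n => exact ⟨n, hn⟩

include hp

theorem root_notMem_descendants {c : V} (hc : c ≠ ρ) : ρ ∉ descendants p c := by
  rintro ⟨n, hn⟩
  rw [Function.iterate_fixed hp.root] at hn
  exact hc hn.symm

theorem rank_lt_of_mem_descendants {c : V} (hc : c ≠ ρ) {z : V} :
    z ∈ descendants p c → z ≠ c → h c < h z := by
  refine hp.induction (P := fun z => z ∈ descendants p c → z ≠ c → h c < h z)
    (fun hz => absurd hz (hp.root_notMem_descendants hc)) (fun z hz ih hzc hne => ?_) z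
  have h1 := hp.lt z hz
  by_cases h2 : p z = c
  · rwa [h2] at h1
  · exact (ih (parent_mem_descendants hzc hne) h2).trans h1

theorem parent_notMem_descendants {c : V} (hc : c ≠ ρ) : p c ∉ descendants p c := fun hm => by
  have h1 := hp.lt c hc
  have h2 := hp.rank_lt_of_mem_descendants hc hm (hp.ne_self hc)
  omega

/-- Cut above a branching vertex `c` of maximal rank. Its proper descendants have larger rank and so
do not branch; thus `c` with its descendants and its parent forms a starlike tree, with the parent
as a leaf. The complement of the descendants is the remaining tree. -/
theorem exists_starlikeSplitting [Finite V] {c : V} (hc : c ≠ ρ)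
    (hρ3 : 3 ≤ (parentGraph p).vdeg ρ) (hc3 : 3 ≤ (parentGraph p).vdeg c)
    (hmax : ∀ x, x ≠ ρ → 3 ≤ (parentGraph p).vdeg x → h x ≤ h c) :
    ∃ (A B : Type u) (S : SimpleGraph A) (T' : SimpleGraph B) (vs : A) (vt : B),
      IsStarlikeSplitting (parentGraph p) S T' vs vt ∧ 1 ≤ T'.vdeg vt ∧ Finite B ∧
      Nat.card B < Nat.card V := by
  classical
  set D := descendants p c with hD
  have hcD : c ∈ D := self_mem_descendants p c
  have hρD : ρ ∉ D := hp.root_notMem_descendants hc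
  have hpcD : p c ∉ D := hp.parent_notMem_descendants hc
  let pS : {z // z ∈ D ∨ z = p c} → {z // z ∈ D ∨ z = p c} := fun z =>
    if hz : z.1 = p c then z else ⟨p z.1, by
      by_cases hzc : z.1 = c
      · exact Or.inr (by rw [hzc])
      · exact Or.inl (parent_mem_descendants (z.2.resolve_right hz) hzc)⟩
  let pB : {z // z ∉ D} → {z // z ∉ D} := fun z =>
    ⟨p z.1, fun hz => z.2 (mem_descendants_of_parent hz)⟩
  let vs : {z // z ∈ D ∨ z = p c} := ⟨p c, Or.inr rfl⟩
  let vt : {z // z ∉ D} := ⟨p c, hpcD⟩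
  have hpSval : ∀ z, z ≠ vs → (pS z).1 = p z.1 := fun z hz => by
    have : z.1 ≠ p c := fun e => hz (Subtype.ext e)
    simp only [pS, dif_neg this]
  have hmemD : ∀ z : {z // z ∈ D ∨ z = p c}, z ≠ vs → z.1 ∈ D := fun z hz =>
    z.2.resolve_right fun e => hz (Subtype.ext e)
  have hS : IsParent pS vs (fun z => h z.1) := by
    refine ⟨dif_pos rfl, fun z hz => ?_⟩
    simp only [hpSval z hz]
    exact hp.lt _ fun e => hρD (e ▸ hmemD z hz)
  have hB : IsParent pB ⟨ρ, hρD⟩ (fun z => h z.1) :=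
    ⟨Subtype.ext hp.root, fun z hz => hp.lt _ fun e => hz (Subtype.ext e)⟩
  have hm : IsMergingVia (parentGraph p) (parentGraph pS) (parentGraph pB) vs vt
      (Function.Embedding.subtype _) (Function.Embedding.subtype _) := by
    have key : ∀ x y, x ≠ ρ → p x = y →
        (∃ a a', (parentGraph pS).Adj a a' ∧ a.1 = x ∧ a'.1 = y) ∨
        (∃ a a', (parentGraph pB).Adj a a' ∧ a.1 = x ∧ a'.1 = y) := by
      rintro x _ hx rfl
      by_cases hxD : x ∈ D
      · left
        have hne : (⟨x, Or.inl hxD⟩ : {z // z ∈ D ∨ z = p c}) ≠ vs := fun e => by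
          have e : x = p c := congrArg Subtype.val e
          exact hpcD (e ▸ hxD)
        exact ⟨⟨x, Or.inl hxD⟩, pS ⟨x, Or.inl hxD⟩, hS.adj_parent hne, rfl, hpSval _ hne⟩
      · right
        exact ⟨⟨x, hxD⟩, pB ⟨x, hxD⟩, hB.adj_parent fun e => hx (congrArg Subtype.val e),
          rfl, rfl⟩
    refine ⟨fun x => ?_, fun a b => ?_, fun x y => ⟨fun hxy => ?_, ?_⟩⟩
    · by_cases hxD : x ∈ D
      · exact Or.inl ⟨⟨x, Or.inl hxD⟩, rfl⟩
      · exact Or.inr ⟨⟨x, hxD⟩, rfl⟩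
    · constructor
      · intro hab
        have hab : a.1 = b.1 := hab
        have h1 : a.1 = p c := a.2.resolve_left (hab ▸ b.2)
        exact ⟨Subtype.ext h1, Subtype.ext (hab ▸ h1)⟩
      · rintro ⟨rfl, rfl⟩
        rfl
    · rcases hp.adj_iff.1 hxy with ⟨hx, hxy⟩ | ⟨hy, hxy⟩
      · exact key x y hx hxy
      · rcases key y x hy hxy with ⟨a, a', h1, h2, h3⟩ | ⟨a, a', h1, h2, h3⟩
        · exact Or.inl ⟨a', a, h1.symm, h3, h2⟩
        · exact Or.inr ⟨a', a, h1.symm, h3, h2⟩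
    · have key1 : ∀ a : {z // z ∈ D ∨ z = p c}, a ≠ vs →
          (parentGraph p).Adj a.1 (pS a).1 := fun a ha => by
        rw [hpSval a ha]
        exact hp.adj_parent fun e => hρD (e ▸ hmemD a ha)
      rintro (⟨a, a', h1, rfl, rfl⟩ | ⟨a, a', h1, rfl, rfl⟩)
      · rcases hS.adj_iff.1 h1 with ⟨h2, rfl⟩ | ⟨h2, rfl⟩
        · exact key1 a h2
        · exact (key1 a' h2).symm
      · rcases hB.adj_iff.1 h1 with ⟨h2, rfl⟩ | ⟨h2, rfl⟩
        · exact hp.adj_parent fun e => h2 (Subtype.ext e)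
        · exact (hp.adj_parent fun e => h2 (Subtype.ext e)).symm
  have hcs : (⟨c, Or.inl hcD⟩ : {z // z ∈ D ∨ z = p c}) ≠ vs := fun e =>
    hp.ne_self hc (congrArg Subtype.val e).symm
  have hvs : (parentGraph pS).vdeg vs = 1 := by
    rw [hS.vdeg_root, Set.ncard_eq_one]
    refine ⟨⟨c, Or.inl hcD⟩, Set.ext fun z => ⟨?_, ?_⟩⟩
    · rintro ⟨h1, h2⟩
      have h3 : p c = p z.1 := by rw [← hpSval z h1, h2]
      by_contra hzc
      exact hpcD (h3 ▸ parent_mem_descendants (hmemD z h1) fun e => hzc (Subtype.ext e))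
    · rintro rfl
      exact ⟨hcs, Subtype.ext (hpSval _ hcs)⟩
  have hcS : 3 ≤ (parentGraph pS).vdeg ⟨c, Or.inl hcD⟩ := by
    rw [← hm.vdeg_left hcs]
    exact hc3
  refine ⟨_, _, parentGraph pS, parentGraph pB, vs, vt, ?_, ?_, inferInstance, ?_⟩
  · refine ⟨hp.isTree, ⟨c, ρ, hc, hc3, hρ3⟩, ⟨hS.isTree, ⟨c, Or.inl hcD⟩, hcS, ?_⟩, hB.isTree,
      hvs, ⟨_, hcS, ?_⟩, ⟨_, _, hm.cover, hm.eq_iff, hm.adj_iff⟩⟩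
    · intro a ha
      have hav : a ≠ vs := by
        rintro rfl
        simp only [hvs] at ha
        omega
      by_contra hac
      have h1 := hp.rank_lt_of_mem_descendants hc (hmemD a hav) fun e => hac (Subtype.ext e)
      have h2 := hm.vdeg_left hav
      have h3 := hmax a.1 (fun e => hρD (e ▸ hmemD a hav)) (h2.symm ▸ ha)
      omega
    · exact hS.adj_iff.2 (Or.inr ⟨hcs, Subtype.ext (hpSval _ hcs)⟩)
  -- The parent of `c` keeps a neighbour in `T'`: two of them if it is the branching root, and
  -- otherwise its own parent.
  · have hglue : (parentGraph p).vdeg (p c) = _ := hm.vdeg_glue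
    rw [hvs] at hglue
    by_cases hpc : p c = ρ
    · rw [hpc] at hglue
      omega
    · rw [hp.vdeg_of_ne hpc] at hglue
      have : 0 < {y | y ≠ ρ ∧ p y = p c}.ncard :=
        (Set.ncard_pos (Set.toFinite _)).2 ⟨c, hc, rfl⟩
      omega
  · exact Finite.card_subtype_lt (x := c) (fun e => e hcD)

end IsParent

theorem IsTree.exists_starlikeDecomposition {V : Type u} [Finite V] {T : SimpleGraph V}
    (hT : T.IsTree) : ∃ m, T.HasStarlikeDecomposition m := by
  rename_i hV
  induction hn : Nat.card V using Nat.strong_induction_on generalizing V with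
  | _ n ih =>
    by_cases hbase : ∀ x y : V, 3 ≤ T.vdeg x → 3 ≤ T.vdeg y → x = y
    · exact ⟨0, .base hT hbase⟩
    · push Not at hbase
      obtain ⟨ρ, y, hρ, hy, hne⟩ := hbase
      obtain ⟨p, h, hp, rfl⟩ := hT.exists_isParent ρ
      obtain ⟨c, ⟨hc, hc3⟩, hmax⟩ := Set.exists_max_image
        {x | x ≠ ρ ∧ 3 ≤ (parentGraph p).vdeg x} h (Set.toFinite _) ⟨y, hne.symm, hy⟩
      obtain ⟨A, B, S, T', vs, vt, hsplit, hdeg, hfin, hcard⟩ :=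
        hp.exists_starlikeSplitting hc hρ hc3 fun x hx hx3 => hmax x ⟨hx, hx3⟩
      obtain ⟨m, hm⟩ := ih _ (hn ▸ hcard) hsplit.isTree' rfl
      rcases hdeg.eq_or_lt with h1 | h1
      · exact ⟨m, .regular hsplit h1.symm hm⟩
      · exact ⟨m + 1, .irregular hsplit h1 hm⟩

/-- The splitting irregularity number of a tree is the largest size of a sparse set of edges. -/
theorem IsTree.hasMaxSparse {V : Type u} [Finite V] {T : SimpleGraph V} (hT : T.IsTree) :
    T.HasMaxSparse T.splittingIrregularity :=
  hasMaxSparse_of_decomposition (Nat.sInf_mem (s := {m | T.HasStarlikeDecomposition m})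
    hT.exists_starlikeDecomposition)

theorem IsTree.splittingIrregularity_eq {V : Type u} [Finite V] {T : SimpleGraph V}
    (hT : T.IsTree) {m : ℕ} (h : T.HasMaxSparse m) : T.splittingIrregularity = m :=
  hT.hasMaxSparse.unique h

/-! ### Subdivisions of rooted trees. -/

/-- The parent function obtained by inserting a new vertex between `a` and its parent. -/
def insertParent {V : Type u} [DecidableEq V] (p : V → V) (a : V) : Option V → Option V
  | none => some (p a)
  | some x => if x = a then none else some (p x)

theorem IsParent.subdivideEdge_eq {V : Type u} [DecidableEq V] {p : V → V} {ρ : V} {h : V → ℕ}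
    (hp : IsParent p ρ h) {a : V} (ha : a ≠ ρ) :
    (parentGraph p).subdivideEdge a (p a) = parentGraph (insertParent p a) := by
  have key : ∀ x y, x ≠ ρ → p x = y → (s(x, y) ≠ s(a, p a) ↔ x ≠ a) := by
    rintro x _ hx rfl
    exact not_congr (hp.injOn_edge.eq_iff hx ha)
  have hne := hp.ne_self ha
  ext x y
  rcases x with _ | x <;> rcases y with _ | y
  · simp [subdivideEdge]
  · simp only [subdivideEdge, parentGraph, fromRel_adj, insertParent]
    grind
  · simp only [subdivideEdge, parentGraph, fromRel_adj, insertParent]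
    grind
  · simp only [subdivideEdge, hp.adj_iff]
    simp only [parentGraph, fromRel_adj, insertParent]
    constructor
    · rintro ⟨⟨h1, h2⟩ | ⟨h1, h2⟩, h3⟩
      · rw [key x y h1 h2] at h3
        have := hp.ne_self h1
        grind
      · rw [Sym2.eq_swap, key y x h1 h2] at h3
        have := hp.ne_self h1
        grind
    · rintro ⟨h1, h2⟩
      have h4 : x ≠ y := by grind
      rcases h2 with h2 | h2
      · have h5 : x ≠ a ∧ p x = y := by grind
        have h6 : x ≠ ρ := fun e => h4 (by rw [← h5.2, e, hp.root])
        exact ⟨Or.inl ⟨h6, h5.2⟩, (key x y h6 h5.2).2 h5.1⟩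
      · have h5 : y ≠ a ∧ p y = x := by grind
        have h6 : y ≠ ρ := fun e => h4 (by rw [← h5.2, e, hp.root])
        refine ⟨Or.inr ⟨h6, h5.2⟩, ?_⟩
        rw [Sym2.eq_swap]
        exact (key y x h6 h5.2).2 h5.1

/-- An equivalence commuting with the parent functions is an isomorphism of parent graphs. -/
def parentGraphIso {V : Type u} {W : Type v} {p : V → V} {q : W → W} (e : V ≃ W)
    (he : ∀ x, q (e x) = e (p x)) : parentGraph p ≃g parentGraph q where
  toEquiv := e
  map_rel_iff' := by
    intro a b
    simp [parentGraph, he]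

/-- The vertices of the subdivision placing `len x` new vertices between `x` and its parent: the
new vertices are the pairs `(x, 1), …, (x, len x)`, counted from `x` to the parent. -/
abbrev SubdivVertex {V : Type u} (len : V → ℕ) : Type u := {w : V × ℕ // w.2 ≤ len w.1}

/-- The vertex `x` of a tree as a vertex of its subdivision. -/
abbrev SubdivVertex.base {V : Type u} (len : V → ℕ) (x : V) : SubdivVertex len :=
  ⟨(x, 0), Nat.zero_le _⟩

/-- The vertex below the parent of `x` in the subdivision. -/
abbrev SubdivVertex.top {V : Type u} (len : V → ℕ) (x : V) : SubdivVertex len :=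
  ⟨(x, len x), le_rfl⟩

open SubdivVertex

/-- The parent function of the subdivision. -/
def subdivParent {V : Type u} (p : V → V) (len : V → ℕ) (w : SubdivVertex len) :
    SubdivVertex len :=
  if hw : w.1.2 < len w.1.1 then ⟨(w.1.1, w.1.2 + 1), hw⟩ else base len (p w.1.1)

theorem subdivParent_of_lt {V : Type u} (p : V → V) {len : V → ℕ} {x : V} {j : ℕ}
    (hj : j < len x) :
    subdivParent p len ⟨(x, j), hj.le⟩ = ⟨(x, j + 1), hj⟩ := dif_pos hj

theorem subdivParent_top {V : Type u} (p : V → V) (len : V → ℕ) (x : V) :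
    subdivParent p len (top len x) = base len (p x) := dif_neg (lt_irrefl _)

instance {V : Type u} [Finite V] (len : V → ℕ) : Finite (SubdivVertex len) := by
  have : Finite (Σ x : V, Fin (len x + 1)) := inferInstance
  refine Finite.of_injective (fun w : SubdivVertex len =>
    (⟨w.1.1, ⟨w.1.2, Nat.lt_succ_of_le w.2⟩⟩ : Σ x : V, Fin (len x + 1))) ?_
  rintro ⟨⟨x, j⟩, hj⟩ ⟨⟨y, k⟩, hk⟩ he
  simp only [Sigma.mk.injEq] at he
  obtain ⟨rfl, h2⟩ := he
  simp only [heq_eq_eq, Fin.mk.injEq] at h2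
  subst h2
  rfl

theorem subdivParent_eq_base {V : Type u} {p : V → V} {len : V → ℕ} {w : SubdivVertex len} {x : V}
    (hw : subdivParent p len w = base len x) : w = top len w.1.1 ∧ p w.1.1 = x := by
  obtain ⟨⟨y, j⟩, hj⟩ := w
  have hj' : j ≤ len y := hj
  rcases hj'.eq_or_lt with rfl | hlt
  · rw [show (⟨(y, len y), hj⟩ : SubdivVertex len) = top len y from rfl, subdivParent_top] at hw
    exact ⟨rfl, congrArg (fun w => w.1.1) hw⟩
  · rw [subdivParent_of_lt p hlt] at hw
    exact absurd (congrArg (fun w => w.1.2) hw) (Nat.succ_ne_zero _)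

theorem SubdivVertex.top_injective {V : Type u} (len : V → ℕ) : Function.Injective (top len) := fun _ _ e =>
  congrArg (fun w => w.1.1) e

theorem subdiv_children_succ {V : Type u} (p : V → V) {ρ : V} {len : V → ℕ} (hρ : len ρ = 0)
    {x : V} {j : ℕ} (hj : j + 1 ≤ len x) :
    {w | w ≠ base len ρ ∧ subdivParent p len w = ⟨(x, j + 1), hj⟩} =
      {⟨(x, j), Nat.le_of_succ_le hj⟩} := by
  ext w
  constructor
  · rintro ⟨h1, h2⟩
    obtain ⟨⟨y, k⟩, hk⟩ := w
    have hk' : k ≤ len y := hk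
    rcases hk'.eq_or_lt with rfl | hlt
    · rw [show (⟨(y, len y), hk⟩ : SubdivVertex len) = top len y from rfl, subdivParent_top] at h2
      exact absurd (congrArg (fun w => w.1.2) h2).symm (Nat.succ_ne_zero _)
    · rw [subdivParent_of_lt p hlt] at h2
      have h3 : y = x := congrArg (fun w => w.1.1) h2
      have h4 : k + 1 = j + 1 := congrArg (fun w => w.1.2) h2
      subst h3
      obtain rfl : k = j := by omega
      rfl
  · rintro rfl
    refine ⟨fun e => ?_, subdivParent_of_lt p hj⟩
    have : x = ρ := congrArg (fun w => w.1.1) e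
    rw [this, hρ] at hj
    omega

theorem subdiv_children_base {V : Type u} (p : V → V) {ρ : V} {len : V → ℕ} (hρ : len ρ = 0)
    (x : V) :
    {w | w ≠ base len ρ ∧ subdivParent p len w = base len x} =
      top len '' {y | y ≠ ρ ∧ p y = x} := by
  ext w
  constructor
  · rintro ⟨h1, h2⟩
    obtain ⟨h3, h4⟩ := subdivParent_eq_base h2
    refine ⟨w.1.1, ⟨fun e => h1 ?_, h4⟩, h3.symm⟩
    rw [h3, e]
    exact Subtype.ext (Prod.ext rfl hρ)
  · rintro ⟨y, ⟨h1, h2⟩, rfl⟩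
    exact ⟨fun e => h1 (congrArg (fun w => w.1.1) e), by rw [subdivParent_top, h2]⟩

theorem IsSubdivision.trans_iso {U : Type u} {G : SimpleGraph U} {W W' : Type v}
    {H : SimpleGraph W} {K : SimpleGraph W'} (hG : G.IsSubdivision H) (e : H ≃g K) :
    G.IsSubdivision K := by
  cases hG with
  | of_iso e' => exact .of_iso (e'.trans e)
  | step h hxy e' => exact .step h hxy (e'.trans e)

/-- Lengthening the leg of `x` by one vertex subdivides the edge from the top of the leg to the
parent of `x`; the vertices already on the leg keep their indices. -/
theorem IsParent.isSubdivision_update {V : Type u} [DecidableEq V] {p : V → V} {ρ : V}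
    {len : V → ℕ} {x : V} (hx : x ≠ ρ) {U : Type v}
    {G : SimpleGraph U} {h' : SubdivVertex len → ℕ}
    (hp' : IsParent (subdivParent p len) (base len ρ) h')
    (hG : G.IsSubdivision (parentGraph (subdivParent p len))) :
    G.IsSubdivision (parentGraph (subdivParent p (Function.update len x (len x + 1)))) := by
  set len' := Function.update len x (len x + 1) with hlen'
  have hlx : len' x = len x + 1 := Function.update_self ..
  have hly : ∀ y, y ≠ x → len' y = len y := fun y hy => Function.update_of_ne hy ..
  have hle : ∀ y, len y ≤ len' y := fun y => by
    by_cases hy : y = x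
    · rw [hy, hlx]; omega
    · rw [hly y hy]
  let e : Option (SubdivVertex len) ≃ SubdivVertex len' :=
    { toFun := fun w => w.elim ⟨(x, len x + 1), hlx.ge⟩ fun w => ⟨w.1, w.2.trans (hle _)⟩
      invFun := fun w => if hw : w.1.2 ≤ len w.1.1 then some ⟨w.1, hw⟩ else none
      left_inv := by
        rintro (_ | w)
        · simp
        · simp [w.2]
      right_inv := by
        rintro ⟨⟨y, k⟩, hk⟩
        by_cases hw : k ≤ len y
        · simp [hw]
        · have hk : k ≤ len' y := hk
          have hy : y = x := by
            by_contra hy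
            rw [hly y hy] at hk
            exact hw hk
          subst hy
          have : k = len y + 1 := by omega
          subst this
          simp }
  have ha : top len x ≠ base len ρ := fun e => hx (congrArg (fun w => w.1.1) e)
  have hadj := hp'.adj_parent ha
  refine .step hG hadj ?_
  rw [hp'.subdivideEdge_eq ha]
  refine parentGraphIso e ?_
  rintro (_ | ⟨⟨y, k⟩, hk⟩)
  · have : e none = top len' x := Subtype.ext (Prod.ext rfl hlx.symm)
    rw [this, subdivParent_top, insertParent, subdivParent_top]
    rfl
  · have hk : k ≤ len y := hk
    have he : e (some ⟨(y, k), hk⟩) = ⟨(y, k), hk.trans (hle _)⟩ := rfl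
    rw [he, insertParent]
    rcases hk.eq_or_lt with rfl | hlt
    · by_cases hy : y = x
      · subst hy
        rw [if_pos rfl, subdivParent_of_lt p (hlx.symm ▸ Nat.lt_succ_self _ : len y < len' y)]
        rfl
      · rw [if_neg fun e => hy (congrArg (fun w => w.1.1) e),
          show (⟨(y, len y), hk⟩ : SubdivVertex len) = top len y from rfl, subdivParent_top]
        have : (⟨(y, len y), hk.trans (hle _)⟩ : SubdivVertex len') = top len' y :=
          Subtype.ext (Prod.ext rfl (hly y hy).symm)
        rw [this, subdivParent_top]
        rfl
    · rw [if_neg, subdivParent_of_lt p hlt, subdivParent_of_lt p (hlt.trans_le (hle y))]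
      · rfl
      · intro e
        have h1 : y = x := congrArg (fun w => w.1.1) e
        have h2 : k = len x := congrArg (fun w => w.1.2) e
        rw [h1, ← h2] at hlt
        exact lt_irrefl _ hlt

namespace IsParent

variable {V : Type u} [Finite V] {p : V → V} {ρ : V} {h : V → ℕ} (hp : IsParent p ρ h)
  {len : V → ℕ} (hρ : len ρ = 0)
include hp hρ

theorem exists_subdiv :
    ∃ h', IsParent (subdivParent p len) (base len ρ) h' := by
  obtain ⟨N, hN⟩ := (Set.finite_range len).bddAbove
  have hN : ∀ x, len x ≤ N := fun x => hN ⟨x, rfl⟩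
  -- Scaling the old rank by more than any leg length leaves room to count down along a leg.
  refine ⟨fun w => (N + 1) * h w.1.1 - w.1.2, ?_, ?_⟩
  · have := subdivParent_top p len ρ
    simp only [top, hρ] at this
    rw [this]
    simp [hp.root]
  · rintro ⟨⟨x, j⟩, hj⟩ hne
    have hx : x ≠ ρ := by
      rintro rfl
      refine hne (Subtype.ext (Prod.ext rfl ?_))
      simp only [hρ] at hj
      exact Nat.le_zero.1 hj
    have h1 := hp.lt x hx
    have h2 := hN x
    have h3 : (N + 1) * (h (p x) + 1) ≤ (N + 1) * h x := Nat.mul_le_mul_left _ h1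
    have hj' : j ≤ len x := hj
    rcases hj'.eq_or_lt with rfl | hlt
    · rw [show (⟨(x, len x), hj⟩ : SubdivVertex len) = top len x from rfl, subdivParent_top]
      simp only
      rw [mul_add] at h3
      omega
    · rw [subdivParent_of_lt p hlt]
      simp only
      rw [mul_add] at h3
      omega

theorem vdeg_base (x : V) :
    (parentGraph (subdivParent p len)).vdeg (base len x) = (parentGraph p).vdeg x := by
  obtain ⟨h', hp'⟩ := hp.exists_subdiv hρ
  have hcard := Set.ncard_image_of_injective {y | y ≠ ρ ∧ p y = x} (top_injective len)
  rw [← subdiv_children_base p hρ x] at hcard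
  by_cases hx : x = ρ
  · subst hx
    rw [hp'.vdeg_root, hp.vdeg_root, hcard]
  · have hx' : base len x ≠ base len ρ := fun e => hx (congrArg (fun w => w.1.1) e)
    rw [hp'.vdeg_of_ne hx', hp.vdeg_of_ne hx, hcard]

theorem vdeg_succ {x : V} {j : ℕ} (hj : j + 1 ≤ len x) :
    (parentGraph (subdivParent p len)).vdeg ⟨(x, j + 1), hj⟩ = 2 := by
  obtain ⟨h', hp'⟩ := hp.exists_subdiv hρ
  rw [hp'.vdeg_of_ne, subdiv_children_succ p hρ hj, Set.ncard_singleton]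
  intro e
  have : x = ρ := congrArg (fun w => w.1.1) e
  rw [this, hρ] at hj
  omega

theorem isSubdivision {U : Type v} {G : SimpleGraph U} (hG : G.IsSubdivision (parentGraph p)) :
    G.IsSubdivision (parentGraph (subdivParent p len)) := by
  classical
  have := Fintype.ofFinite V
  induction hn : ∑ x, len x generalizing len with
  | zero =>
    have h0 : ∀ x, len x = 0 := fun x => by
      simpa using (Finset.sum_eq_zero_iff.1 hn) x (Finset.mem_univ x)
    let e : V ≃ SubdivVertex len :=
      { toFun := base len
        invFun := fun w => w.1.1
        left_inv := fun _ => rfl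
        right_inv := fun w => by
          have : w.1.2 = 0 := Nat.le_zero.1 (w.2.trans_eq (h0 _))
          exact Subtype.ext (Prod.ext rfl this.symm) }
    refine hG.trans_iso (parentGraphIso e fun x => ?_)
    have : e x = top len x := Subtype.ext (Prod.ext rfl (h0 x).symm)
    rw [this, subdivParent_top]
    rfl
  | succ n ih =>
    obtain ⟨x, -, hx⟩ : ∃ x ∈ Finset.univ, len x ≠ 0 := by
      by_contra hcon
      push Not at hcon
      rw [Finset.sum_eq_zero hcon] at hn
      omega
    have hxρ : x ≠ ρ := fun e => hx (e ▸ hρ)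
    -- Remove one new vertex from a nonempty leg and put it back with `isSubdivision_update`.
    set len' := Function.update len x (len x - 1) with hlen'
    have hx' : len' x = len x - 1 := Function.update_self ..
    have hρ' : len' ρ = 0 := by rw [hlen', Function.update_of_ne hxρ.symm, hρ]
    have hsum : ∑ y, len' y = n := by
      rw [hlen', Finset.sum_update_of_mem (Finset.mem_univ x)]
      rw [← Finset.add_sum_erase _ _ (Finset.mem_univ x)] at hn
      rw [← Finset.erase_eq]
      omega
    obtain ⟨h', hp'⟩ := hp.exists_subdiv hρ'
    have := IsParent.isSubdivision_update hxρ hp' (ih hρ' hsum)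
    rwa [hx', Nat.sub_add_cancel (Nat.one_le_iff_ne_zero.2 hx), hlen', Function.update_idem,
      Function.update_eq_self] at this

/-- New vertices have degree 2, so an edge of a sparse set is an unsubdivided leg. It belongs to `M`
or ends at the root, and the latter is excluded by the small degree of the root. Hence every sparse
set lies inside the image of `M`. -/
theorem hasMaxSparse_subdiv {M : Set (Sym2 V)} (hM : (parentGraph p).IsSparse M)
    (hleaf : (parentGraph p).vdeg ρ ≤ 2)
    (hlen : ∀ x, x ≠ ρ → (len x = 0 ↔ s(x, p x) ∈ M ∨ p x = ρ)) :
    (parentGraph (subdivParent p len)).HasMaxSparse M.ncard := by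
  obtain ⟨h', hp'⟩ := hp.exists_subdiv hρ
  let b : V ↪ SubdivVertex len := ⟨base len, fun _ _ e => congrArg (fun w => w.1.1) e⟩
  have hcard := Set.ncard_image_of_injective M (Sym2.map.injective b.injective)
  refine ⟨⟨Sym2.map b '' M, ⟨?_, ?_⟩, hcard⟩, fun N hN => ?_⟩
  · rintro _ ⟨e, he, rfl⟩
    have := hM.1 he
    rw [hp.edgeSet_eq] at this
    obtain ⟨x, hx, rfl⟩ := this
    have h0 : len x = 0 := (hlen x hx).2 (Or.inl he)
    simp only [Sym2.map_mk]
    rw [hp'.edgeSet_eq]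
    refine ⟨b x, fun e => hx (congrArg (fun w => w.1.1) e), ?_⟩
    have : b x = top len x := Subtype.ext (Prod.ext rfl h0.symm)
    simp only
    rw [this, subdivParent_top]
    rfl
  · rintro ⟨⟨x, _ | j⟩, hj⟩
    · rw [show (⟨(x, 0), hj⟩ : SubdivVertex len) = b x from rfl, ncard_incident_image]
      exact (hM.2 x).trans_eq (by rw [← hp.vdeg_base hρ x]; rfl)
    · rw [(Set.ncard_eq_zero (Set.toFinite _)).2]
      · exact Nat.zero_le _
      · rw [Set.eq_empty_iff_forall_notMem]
        rintro _ ⟨⟨e, he, rfl⟩, hx⟩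
        obtain ⟨y, -, hy⟩ := Sym2.mem_map.1 hx
        exact Nat.succ_ne_zero j (congrArg (fun w => w.1.2) hy).symm
  · rw [← hcard]
    refine Set.ncard_le_ncard fun e he => ?_
    have hhigh := fun v => hN.three_le_vdeg (v := v) he
    have hT := hN.1 he
    rw [hp'.edgeSet_eq] at hT
    obtain ⟨w, hw, rfl⟩ := hT
    have key : ∀ w, 3 ≤ (parentGraph (subdivParent p len)).vdeg w → w = base len w.1.1 := by
      rintro ⟨⟨x, _ | j⟩, hj⟩ h3
      · rfl
      · rw [hp.vdeg_succ hρ hj] at h3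
        omega
    have hw1 := hhigh w (Sym2.mem_mk_left _ _)
    have hw2 := hhigh _ (Sym2.mem_mk_right _ _)
    have h1 := key _ hw1
    have h2 := key _ hw2
    obtain ⟨h3, h4⟩ := subdivParent_eq_base h2
    set x := w.1.1
    have hx : x ≠ ρ := fun e => hw (by rw [h1, e])
    have hl : len x = 0 := (congrArg (fun w => w.1.2) (h3.symm.trans h1))
    rcases (hlen x hx).1 hl with h5 | h5
    · refine ⟨_, h5, ?_⟩
      simp only [Sym2.map_mk]
      rw [h2, ← h4, h1]
      rfl
    · rw [h2, ← h4, hp.vdeg_base hρ, h5] at hw2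
      omega

end IsParent

/-! ### Harmonic functions and the cokernel of the Laplacian. -/

section Harmonic

variable {V : Type u} [Fintype V]

open Classical in
/-- `X` satisfies the relation `d x • X x = ∑ X y`, summed over the neighbours `y` of `x`, at every
vertex. -/
def IsHarmonic {P : Type v} [AddCommGroup P] (G : SimpleGraph V) (d : V → ℤ) (X : V → P) : Prop :=
  ∀ x, d x • X x = ∑ y with G.Adj x y, X y

open Classical in
theorem genLaplacian_mulVec [DecidableEq V] (G : SimpleGraph V) (d v : V → ℤ) (x : V) :
    (G.genLaplacian d).mulVec v x = d x * v x - ∑ y with G.Adj x y, v y := by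
  rw [genLaplacian, Matrix.sub_mulVec, Pi.sub_apply, Matrix.mulVec_diagonal]
  congr 1
  simp [Matrix.mulVec, dotProduct, Finset.sum_filter, adjMatrix_apply]

/-- By symmetry of the Laplacian, a harmonic function factors through the cokernel. -/
theorem IsHarmonic.linearCombination_mulVec [DecidableEq V] {P : Type v} [AddCommGroup P]
    {G : SimpleGraph V} {d : V → ℤ} {X : V → P} (hX : G.IsHarmonic d X) (v : V → ℤ) :
    Fintype.linearCombination ℤ X ((G.genLaplacian d).mulVec v) = 0 := by
  classical
  simp only [Fintype.linearCombination_apply, genLaplacian_mulVec, sub_smul, Finset.sum_sub_distrib,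
    Finset.sum_smul]
  rw [sub_eq_zero]
  simp only [Finset.sum_filter]
  rw [Finset.sum_comm]
  refine Finset.sum_congr rfl fun y _ => ?_
  rw [mul_comm, mul_smul, hX y, Finset.smul_sum, Finset.sum_filter]
  exact Finset.sum_congr rfl fun x _ => by rw [G.adj_comm]

/-- The tautological harmonic function with values in the cokernel of the Laplacian. -/
theorem isHarmonic_mk [DecidableEq V] (G : SimpleGraph V) (d : V → ℤ) :
    G.IsHarmonic d fun x => (Submodule.Quotient.mk (Pi.single x 1) :
      (V → ℤ) ⧸ LinearMap.range (G.genLaplacian d).mulVecLin) := by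
  classical
  intro x
  have key : (G.genLaplacian d).mulVec (Pi.single x 1) =
      d x • (Pi.single x 1 : V → ℤ) - ∑ y with G.Adj x y, Pi.single y 1 := by
    ext z
    rw [genLaplacian_mulVec, Pi.sub_apply, Finset.sum_apply, Pi.smul_apply]
    congr 1
    · by_cases hz : z = x
      · subst hz; simp
      · simp [Pi.single_eq_of_ne hz]
    · simp [Pi.single_apply, Finset.sum_ite_eq, G.adj_comm]
  rw [← Submodule.Quotient.mk_smul, ← sub_eq_zero]
  have hsum : ∑ y with G.Adj x y, (Submodule.Quotient.mk (Pi.single y 1) :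
      (V → ℤ) ⧸ LinearMap.range (G.genLaplacian d).mulVecLin) =
      Submodule.Quotient.mk (∑ y with G.Adj x y, Pi.single y 1) := by
    rw [← Submodule.mkQ_apply, map_sum]
    rfl
  rw [hsum, ← Submodule.Quotient.mk_sub, ← key, Submodule.Quotient.mk_eq_zero]
  exact ⟨Pi.single x 1, rfl⟩

/-- A generating harmonic function with values in `ℤ × K` through which the tautological harmonic
function factors identifies the critical group with `K`. -/
theorem ArithmeticalStructure.nonempty_criticalGroup_equiv [DecidableEq V] {G : SimpleGraph V}
    (A : G.ArithmeticalStructure) {K : Type v} [AddCommGroup K] [Finite K] {X : V → ℤ × K}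
    (hX : G.IsHarmonic A.d X) (hgen : Submodule.span ℤ (Set.range X) = ⊤)
    (ψ : ℤ × K →+ (V → ℤ) ⧸ LinearMap.range (G.genLaplacian A.d).mulVecLin)
    (hψ : ∀ x, ψ (X x) = Submodule.Quotient.mk (Pi.single x 1)) :
    Nonempty (A.CriticalGroup ≃+ K) := by
  let Φ : ((V → ℤ) ⧸ LinearMap.range (G.genLaplacian A.d).mulVecLin) →ₗ[ℤ] ℤ × K :=
    Submodule.liftQ _ (Fintype.linearCombination ℤ X) (by
      rintro _ ⟨v, rfl⟩
      exact hX.linearCombination_mulVec v)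
  have hΦ : ∀ v, Φ (Submodule.Quotient.mk v) = Fintype.linearCombination ℤ X v := fun v => rfl
  have hsurj : Function.Surjective Φ := by
    intro z
    have hz : z ∈ Submodule.span ℤ (Set.range X) := hgen ▸ Submodule.mem_top
    rw [← Fintype.range_linearCombination] at hz
    obtain ⟨v, rfl⟩ := hz
    exact ⟨_, hΦ v⟩
  -- The left inverse need only be checked on the classes of the standard basis vectors, where it is
  -- the hypothesis on `ψ`.
  have hleft : ∀ q, ψ (Φ q) = q := by
    intro q
    obtain ⟨v, rfl⟩ := Submodule.Quotient.mk_surjective _ q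
    rw [hΦ, Fintype.linearCombination_apply, map_sum]
    simp only [map_zsmul, hψ]
    conv_rhs => rw [pi_eq_sum_univ v]
    rw [← Submodule.mkQ_apply, map_sum]
    refine Finset.sum_congr rfl fun x _ => ?_
    rw [map_smul]
    congr 2
    ext y
    simp [Pi.single_apply, eq_comm]
  have hinj : Function.Injective Φ := Function.LeftInverse.injective hleft
  let f : A.CriticalGroup →+ K :=
    (AddMonoidHom.snd ℤ K).comp (Φ.toAddMonoidHom.comp (Submodule.subtype _).toAddMonoidHom)
  have hf : ∀ t, f t = (Φ t.1).2 := fun t => rfl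
  refine ⟨AddEquiv.ofBijective f ⟨?_, fun k => ?_⟩⟩
  · rw [injective_iff_map_eq_zero]
    rintro ⟨q, hq⟩ h0
    rw [hf] at h0
    rw [Submodule.mem_torsion_iff] at hq
    obtain ⟨a, ha⟩ := hq
    -- A torsion class has zero `ℤ`-coordinate, so its `K`-coordinate determines it.
    have h1 : (a : ℤ) * (Φ q).1 = 0 := by
      have h : Φ ((a : ℤ) • q) = 0 := (congrArg Φ ha).trans (map_zero Φ)
      rw [map_zsmul] at h
      exact congrArg Prod.fst h
    have h2 : (Φ q).1 = 0 := by
      rcases mul_eq_zero.1 h1 with h | h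
      · exact absurd h (nonZeroDivisors.ne_zero a.2)
      · exact h
    have h3 : Φ q = 0 := Prod.ext h2 h0
    exact Subtype.ext (hinj (h3.trans (map_zero Φ).symm))
  · obtain ⟨q, hq⟩ := hsurj (0, k)
    refine ⟨⟨q, ?_⟩, ?_⟩
    · rw [Submodule.mem_torsion_iff]
      have hn : (Nat.card K : ℤ) ≠ 0 := by exact_mod_cast Nat.card_pos.ne'
      refine ⟨⟨Nat.card K, mem_nonZeroDivisors_of_ne_zero hn⟩, hinj ?_⟩
      change Φ ((Nat.card K : ℤ) • q) = _
      rw [map_zsmul, hq, map_zero]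
      ext
      · simp
      · simp
    · rw [hf]
      simp only [hq]

end Harmonic

open SubdivVertex

/-! ### From root data to harmonic functions. -/

section Legs

open scoped Classical

variable {V : Type u} [Fintype V]

theorem IsParent.isHarmonic_subdiv_iff {p : V → V} {ρ : V} {h : V → ℕ} (hp : IsParent p ρ h)
    {len : V → ℕ} (hρ : len ρ = 0) [Fintype (SubdivVertex len)] (D : V → ℕ → ℤ)
    {P : Type v} [AddCommGroup P] (X : SubdivVertex len → P) :
    (parentGraph (subdivParent p len)).IsHarmonic (fun w => D w.1.1 w.1.2) X ↔
      D ρ 0 • X (base len ρ) = ∑ y with y ≠ ρ ∧ p y = ρ, X (top len y) ∧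
      (∀ x, x ≠ ρ → D x 0 • X (base len x) =
        X (subdivParent p len (base len x)) + ∑ y with y ≠ ρ ∧ p y = x, X (top len y)) ∧
      ∀ x j, (hj : j + 1 ≤ len x) → D x (j + 1) • X ⟨(x, j + 1), hj⟩ =
        X (subdivParent p len ⟨(x, j + 1), hj⟩) + X ⟨(x, j), Nat.le_of_succ_le hj⟩ := by
  obtain ⟨h', hp'⟩ := hp.exists_subdiv hρ
  have hbase : ∀ x, ∑ w with w ≠ base len ρ ∧ subdivParent p len w = base len x, X w =
      ∑ y with y ≠ ρ ∧ p y = x, X (top len y) := by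
    intro x
    rw [← Finset.sum_image (g := top len) (fun _ _ _ _ e => top_injective len e)]
    congr 1
    have := subdiv_children_base p hρ x
    ext w
    simpa using Set.ext_iff.1 this w
  have hsucc : ∀ x j, (hj : j + 1 ≤ len x) →
      ∑ w with w ≠ base len ρ ∧ subdivParent p len w = ⟨(x, j + 1), hj⟩, X w =
      X ⟨(x, j), Nat.le_of_succ_le hj⟩ := by
    intro x j hj
    rw [← Finset.sum_singleton X ⟨(x, j), Nat.le_of_succ_le hj⟩]
    congr 1
    have := subdiv_children_succ p hρ hj
    ext w
    simpa using Set.ext_iff.1 this w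
  have hne : ∀ {x}, x ≠ ρ → base len x ≠ base len ρ := fun hx e =>
    hx (congrArg (fun w => w.1.1) e)
  have hne' : ∀ x j, (hj : j + 1 ≤ len x) →
      (⟨(x, j + 1), hj⟩ : SubdivVertex len) ≠ base len ρ := fun x j hj e =>
    absurd (congrArg (fun w => w.1.2) e) (Nat.succ_ne_zero j)
  constructor
  · intro H
    refine ⟨?_, fun x hx => ?_, fun x j hj => ?_⟩
    · have := H (base len ρ)
      rwa [hp'.sum_neighbors, if_pos rfl, zero_add, hbase] at this
    · have := H (base len x)
      rwa [hp'.sum_neighbors, if_neg (hne hx), hbase] at this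
    · have := H ⟨(x, j + 1), hj⟩
      rwa [hp'.sum_neighbors, if_neg (hne' x j hj), hsucc] at this
  · rintro ⟨h1, h2, h3⟩ ⟨⟨x, _ | j⟩, hj⟩
    · by_cases hx : x = ρ
      · subst hx
        rw [hp'.sum_neighbors, if_pos rfl, zero_add]
        exact h1.trans (hbase x).symm
      · rw [hp'.sum_neighbors, if_neg (hne hx)]
        exact (h2 x hx).trans (congrArg _ (hbase x).symm)
    · rw [hp'.sum_neighbors, if_neg (hne' x j hj), hsucc]
      exact h3 x j hj

/-- Multiplicities along the legs of a subdivided rooted tree. The leg of `x` runs from `x` (index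
`0`) to the parent of `x` (index `len x + 1`), and carries the multiples `F x j` of the value at
index `1`. Every branching point has a special leg `s x` below it, the legs marked by `Ord` carry a
cyclic factor of order `α`, and all others are single edges. -/
structure LegData (p : V → V) (ρ : V) (len : V → ℕ) where
  F : V → ℕ → ℤ
  D : V → ℕ → ℤ
  α : V → ℕ
  q : V → ℤ
  R : ℤ
  s : V → V
  Ord : V → Prop
  len_root : len ρ = 0
  F_pos : ∀ x j, j ≤ len x + 1 → 0 < F x j
  F_one : ∀ x, F x 1 = 1
  F_root : F ρ 0 = 1
  rel : ∀ x j, j + 1 ≤ len x → D x (j + 1) * F x (j + 1) = F x j + F x (j + 2)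
  leaf : ∀ x, x ≠ ρ → (∀ y, y ≠ ρ → p y ≠ x) → F x 0 = 1 ∧ D x 0 = 1
  nonleaf : ∀ x, x ≠ ρ → (∃ y, y ≠ ρ ∧ p y = x) → F x 0 = R
  R_pos : 0 < R
  special : ∀ x, x ≠ ρ → (∃ y, y ≠ ρ ∧ p y = x) →
    s x ≠ ρ ∧ p (s x) = x ∧ ¬ Ord (s x) ∧ F (s x) (len (s x) + 1) = R ∧ 1 ≤ len (s x)
  ord : ∀ x, Ord x → x ≠ ρ ∧ p x ≠ ρ ∧ len x = 1 ∧ F x 2 = α x ∧ x ≠ s (p x)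
  α_pos : ∀ x, 0 < α x
  q_mul : ∀ x, q x * α x = R
  α_eq_one : ∀ x, ¬ Ord x → α x = 1
  single : ∀ x, x ≠ ρ → ¬ Ord x → (p x = ρ ∨ x ≠ s (p x)) → len x = 0
  centre : ∀ x, x ≠ ρ → (∃ y, y ≠ ρ ∧ p y = x) →
    (D x 0 - ∑ y with (y ≠ ρ ∧ p y = x) ∧ len y = 0, F y 0) * R =
      1 + F (s x) (len (s x)) + ∑ y with (y ≠ ρ ∧ p y = x) ∧ Ord y, q y
  D_root : D ρ 0 = ∑ y with y ≠ ρ ∧ p y = ρ, F y 0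

namespace LegData

variable {p : V → V} {ρ : V} {h : V → ℕ} {len : V → ℕ} (L : LegData p ρ len)
  {P : Type v} [AddCommGroup P]

theorem sum_children {x : V} (hx : x ≠ ρ) (hch : ∃ y, y ≠ ρ ∧ p y = x) (f : V → P) :
    ∑ y with y ≠ ρ ∧ p y = x, f y = f (L.s x) +
      ∑ y with (y ≠ ρ ∧ p y = x) ∧ L.Ord y, f y +
      ∑ y with (y ≠ ρ ∧ p y = x) ∧ len y = 0, f y := by
  obtain ⟨h1, h2, h3, h4, h5⟩ := L.special x hx hch
  rw [← Finset.sum_insert (by simp [h3]), ← Finset.sum_union]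
  · congr 1
    ext y
    simp only [Finset.mem_filter, Finset.mem_univ, true_and, Finset.mem_union, Finset.mem_insert]
    constructor
    · rintro ⟨hy, hyx⟩
      by_cases ho : L.Ord y
      · exact Or.inl (Or.inr ⟨⟨hy, hyx⟩, ho⟩)
      · by_cases hs : y = L.s x
        · exact Or.inl (Or.inl hs)
        · exact Or.inr ⟨⟨hy, hyx⟩, L.single y hy ho (Or.inr (by rwa [hyx]))⟩
    · rintro ((rfl | h) | h)
      · exact ⟨h1, h2⟩
      · exact h.1
      · exact h.1
  · rw [Finset.disjoint_left]
    simp only [Finset.mem_insert, Finset.mem_filter, Finset.mem_univ, true_and]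
    rintro y (rfl | ⟨-, h⟩) ⟨-, h0⟩
    · omega
    · have := (L.ord y h).2.2.1
      omega

/-- The recursion satisfied by the values at index `1` of the legs of a harmonic function. -/
def IsSolution (a : P) (e : V → P) (τ : V → P) : Prop :=
  τ ρ = a ∧ ∀ x, x ≠ ρ → τ x =
    if L.Ord x then e x + L.q x • (τ (p x) + ∑ y with (y ≠ ρ ∧ p y = p x) ∧ L.Ord y, e y)
    else if len x = 0 then L.F (p x) 0 • τ (p x)
    else τ (p x) + ∑ y with (y ≠ ρ ∧ p y = p x) ∧ L.Ord y, e y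

variable (hp : IsParent p ρ h)

include hp in
theorem exists_isSolution (a : P) (e : V → P) : ∃ τ, L.IsSolution a e τ :=
  hp.exists_rec a fun x t =>
    if L.Ord x then e x + L.q x • (t + ∑ y with (y ≠ ρ ∧ p y = p x) ∧ L.Ord y, e y)
    else if len x = 0 then L.F (p x) 0 • t
    else t + ∑ y with (y ≠ ρ ∧ p y = p x) ∧ L.Ord y, e y

include hp in
theorem IsSolution.unique {a : P} {e τ τ' : V → P} (hτ : L.IsSolution a e τ)
    (hτ' : L.IsSolution a e τ') : τ = τ' := by
  refine funext (hp.induction (hτ.1.trans hτ'.1.symm) fun x hx ih => ?_)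
  rw [hτ.2 x hx, hτ'.2 x hx, ih]

theorem IsSolution.map {L : LegData p ρ len} {a : P} {e τ : V → P} (hτ : L.IsSolution a e τ)
    {P' : Type*} [AddCommGroup P'] (f : P →+ P') :
    L.IsSolution (f a) (fun x => f (e x)) (fun x => f (τ x)) := by
  refine ⟨congrArg f hτ.1, fun x hx => ?_⟩
  simp only [hτ.2 x hx]
  split_ifs <;> simp only [map_add, map_zsmul, map_sum]

theorem IsSolution.special {L : LegData p ρ len} {a : P} {e τ : V → P}
    (hτ : L.IsSolution a e τ) {x : V} (hx : x ≠ ρ) (hch : ∃ y, y ≠ ρ ∧ p y = x) :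
    τ (L.s x) = τ x + ∑ y with (y ≠ ρ ∧ p y = x) ∧ L.Ord y, e y := by
  obtain ⟨h1, h2, h3, h4, h5⟩ := L.special x hx hch
  rw [hτ.2 _ h1, if_neg h3, if_neg (by omega), h2]

theorem IsSolution.ord {L : LegData p ρ len} {a : P} {e τ : V → P}
    (hτ : L.IsSolution a e τ) {x : V} (hx : L.Ord x) :
    τ x = e x + L.q x • τ (L.s (p x)) := by
  obtain ⟨h1, h2, -⟩ := L.ord x hx
  rw [hτ.2 _ h1, if_pos hx, hτ.special h2 ⟨x, h1, rfl⟩]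

theorem IsSolution.single {L : LegData p ρ len} {a : P} {e τ : V → P}
    (hτ : L.IsSolution a e τ) {x : V} (hx : x ≠ ρ) (h0 : len x = 0) :
    τ x = L.F (p x) 0 • τ (p x) := by
  rw [hτ.2 _ hx, if_neg, if_pos h0]
  intro ho
  have := (L.ord x ho).2.2.1
  omega

/-- The function on the vertices determined by the values at index `1` of the legs. -/
def extend (τ : V → P) (w : SubdivVertex len) : P := L.F w.1.1 w.1.2 • τ w.1.1

theorem smul_sum_ord {e : V → P} (he : ∀ x, L.α x • e x = 0) (x : V) :
    L.R • ∑ y with (y ≠ ρ ∧ p y = x) ∧ L.Ord y, e y = 0 := by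
  rw [Finset.smul_sum]
  refine Finset.sum_eq_zero fun y _ => ?_
  rw [← L.q_mul y, mul_smul, natCast_zsmul, he, smul_zero]

/-- The parent end of a leg must receive the same value from every leg arriving there. For a leg
with a cyclic factor, `α` kills the generator and `α q = R`; for a special leg, `R` kills all
generators at the branching point. -/
theorem IsSolution.top {L : LegData p ρ len} {a : P} {e τ : V → P}
    (hτ : L.IsSolution a e τ) (he : ∀ x, L.α x • e x = 0) {x : V} (hx : x ≠ ρ) :
    L.F x (len x + 1) • τ x = L.F (p x) 0 • τ (p x) := by
  by_cases ho : L.Ord x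
  · obtain ⟨h1, h2, h3, h4, h5⟩ := L.ord x ho
    rw [h3, h4, hτ.ord ho, hτ.special h2 ⟨x, h1, rfl⟩, L.nonleaf _ h2 ⟨x, h1, rfl⟩, smul_add,
      natCast_zsmul, he, zero_add, smul_smul, mul_comm, L.q_mul, smul_add, L.smul_sum_ord he,
      add_zero]
  · by_cases h0 : len x = 0
    · rw [h0, L.F_one, one_smul, hτ.single hx h0]
    · have h1 : ¬ (p x = ρ ∨ x ≠ L.s (p x)) := fun hc => h0 (L.single x hx ho hc)
      push Not at h1
      obtain ⟨h2, h3, h4, h5, h6⟩ := L.special (p x) h1.1 ⟨x, hx, rfl⟩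
      have h7 := hτ.special h1.1 ⟨x, hx, rfl⟩
      rw [← h1.2] at h5 h7
      rw [h5, h7, smul_add, L.smul_sum_ord he, add_zero, L.nonleaf _ h1.1 ⟨x, hx, rfl⟩]

theorem IsSolution.extend_parent {L : LegData p ρ len} {a : P} {e τ : V → P}
    (hτ : L.IsSolution a e τ) (he : ∀ x, L.α x • e x = 0) {x : V} (hx : x ≠ ρ) {j : ℕ}
    (hj : j ≤ len x) :
    L.extend τ (subdivParent p len ⟨(x, j), hj⟩) = L.F x (j + 1) • τ x := by
  rcases hj.eq_or_lt with rfl | hlt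
  · rw [show (⟨(x, len x), hj⟩ : SubdivVertex len) = SubdivVertex.top len x from rfl,
      subdivParent_top]
    exact (hτ.top he hx).symm
  · rw [subdivParent_of_lt p hlt]
    rfl

include hp in
-- The field `centre` is the relation at `x` divided by `t = τ (s x)`: the value at `x` is `R • t`,
-- and up to generators the neighbours contribute `t` from above, `q y • t` from each leg with a
-- factor, the last inner term of the special leg, and multiples of `R • t` from single edges. The
-- generators cancel because `t - τ x` is their sum.
theorem IsSolution.isHarmonic [Fintype (SubdivVertex len)] {L : LegData p ρ len} {a : P}
    {e τ : V → P} (hτ : L.IsSolution a e τ) (he : ∀ x, L.α x • e x = 0) :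
    (parentGraph (subdivParent p len)).IsHarmonic (fun w => L.D w.1.1 w.1.2) (L.extend τ) := by
  rw [hp.isHarmonic_subdiv_iff L.len_root]
  refine ⟨?_, fun x hx => ?_, fun x j hj => ?_⟩
  · rw [L.D_root, Finset.sum_smul]
    refine Finset.sum_congr rfl fun y hy => ?_
    simp only [Finset.mem_filter, Finset.mem_univ, true_and] at hy
    have h0 : len y = 0 := L.single y hy.1 (fun ho => (L.ord y ho).2.1 hy.2) (Or.inl hy.2)
    rw [extend, extend]
    simp only [h0]
    rw [hτ.single hy.1 h0, hy.2, L.F_root, one_smul]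
  · rw [hτ.extend_parent he hx (Nat.zero_le _), zero_add, L.F_one, one_smul]
    by_cases hch : ∃ y, y ≠ ρ ∧ p y = x
    · obtain ⟨h1, h2, h3, h4, h5⟩ := L.special x hx hch
      rw [L.sum_children hx hch]
      have hs := hτ.special hx hch
      have hord : ∑ y with (y ≠ ρ ∧ p y = x) ∧ L.Ord y, L.extend τ (SubdivVertex.top len y) =
          ∑ y with (y ≠ ρ ∧ p y = x) ∧ L.Ord y, e y +
          (∑ y with (y ≠ ρ ∧ p y = x) ∧ L.Ord y, L.q y) • τ (L.s x) := by
        rw [Finset.sum_smul, ← Finset.sum_add_distrib]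
        refine Finset.sum_congr rfl fun y hy => ?_
        simp only [Finset.mem_filter, Finset.mem_univ, true_and] at hy
        rw [extend]
        simp only [(L.ord y hy.2).2.2.1]
        rw [L.F_one, one_smul, hτ.ord hy.2, hy.1.2]
      have hsing : ∑ y with (y ≠ ρ ∧ p y = x) ∧ len y = 0, L.extend τ (SubdivVertex.top len y) =
          (∑ y with (y ≠ ρ ∧ p y = x) ∧ len y = 0, L.F y 0) • L.R • τ x := by
        rw [Finset.sum_smul]
        refine Finset.sum_congr rfl fun y hy => ?_
        simp only [Finset.mem_filter, Finset.mem_univ, true_and] at hy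
        rw [extend]
        simp only [hy.2]
        rw [hτ.single hy.1.1 hy.2, hy.1.2, L.nonleaf x hx hch]
      have hR : L.R • τ x = L.R • τ (L.s x) := by
        rw [hs, smul_add, L.smul_sum_ord he, add_zero]
      rw [hord, hsing]
      have hc := congrArg (· • τ (L.s x)) (L.centre x hx hch)
      simp only [mul_smul, ← hR, sub_smul, add_smul, one_smul, sub_eq_iff_eq_add] at hc
      simp only [extend, L.nonleaf x hx hch]
      rw [hc]
      nth_rewrite 1 [hs]
      abel
    · push Not at hch
      obtain ⟨h1, h2⟩ := L.leaf x hx hch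
      have : ({y | y ≠ ρ ∧ p y = x} : Finset V) = ∅ := by
        ext y
        simpa using hch y
      rw [this, Finset.sum_empty, add_zero, h2, one_smul, extend]
      simp only [h1, one_smul]
  · have hx : x ≠ ρ := by
      rintro rfl
      have := L.len_root
      omega
    rw [hτ.extend_parent he hx hj]
    simp only [extend]
    rw [smul_smul, L.rel x j hj, add_smul, add_comm]

end LegData

end Legs

open SubdivVertex

/-! ### From harmonic functions back to root data. -/

section LegSequence

variable {V : Type u} {p : V → V} {len : V → ℕ} {P : Type v}

namespace LegData

/-- The value of `X` at index `1` of the leg of `x`. -/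
def legValue (p : V → V) {len : V → ℕ} (X : SubdivVertex len → P) (x : V) : P :=
  X (subdivParent p len (base len x))

/-- The values of `X` along the leg of `x`, including the end points. -/
def legSequence (p : V → V) {len : V → ℕ} (X : SubdivVertex len → P) (x : V) (j : ℕ) : P :=
  if hj : j ≤ len x then X ⟨(x, j), hj⟩ else X (base len (p x))

theorem legSequence_of_le (X : SubdivVertex len → P) {x : V} {j : ℕ} (hj : j ≤ len x) :
    legSequence p X x j = X ⟨(x, j), hj⟩ := dif_pos hj

theorem legSequence_end (X : SubdivVertex len → P) (x : V) :
    legSequence p X x (len x + 1) = X (base len (p x)) := dif_neg (by omega)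

theorem legSequence_succ (X : SubdivVertex len → P) {x : V} {j : ℕ} (hj : j ≤ len x) :
    X (subdivParent p len ⟨(x, j), hj⟩) = legSequence p X x (j + 1) := by
  rcases hj.eq_or_lt with rfl | hlt
  · rw [legSequence_end, ← subdivParent_top]
  · rw [subdivParent_of_lt p hlt, legSequence_of_le X hlt]

theorem legValue_of_len_eq_zero (X : SubdivVertex len → P) {x : V} (hx : len x = 0) :
    legValue p X x = X (base len (p x)) := by
  rw [← subdivParent_top]
  exact congrArg (fun w => X (subdivParent p len w)) (Subtype.ext (Prod.ext rfl hx.symm))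

end LegData

end LegSequence

section Legs

open scoped Classical

variable {V : Type u} [Fintype V]

namespace LegData

variable {p : V → V} {ρ : V} {h : V → ℕ} {len : V → ℕ} (L : LegData p ρ len)
  {P : Type v} [AddCommGroup P]

/-- The cyclic generator attached to the leg of `x`. -/
noncomputable def legGenerator (X : SubdivVertex len → P) (x : V) : P :=
  if L.Ord x then legValue p X x - L.q x • legValue p X (L.s (p x)) else 0

section Harmonic

variable (hp : IsParent p ρ h) [Fintype (SubdivVertex len)] {X : SubdivVertex len → P}
  (hX : (parentGraph (subdivParent p len)).IsHarmonic (fun w => L.D w.1.1 w.1.2) X)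

include hp hX

/-- Two consecutive values determine the next, since inner vertices of a leg have degree 2. -/
theorem legSequence_eq {x : V} (hA : X (base len x) = L.F x 0 • legValue p X x) (j : ℕ) :
    j ≤ len x → legSequence p X x j = L.F x j • legValue p X x ∧
      legSequence p X x (j + 1) = L.F x (j + 1) • legValue p X x := by
  induction j with
  | zero =>
    intro hj
    refine ⟨(legSequence_of_le X hj).trans hA, ?_⟩
    rw [zero_add, L.F_one, one_smul, ← zero_add 1, ← legSequence_succ X hj]
    rfl
  | succ j ih =>
    intro hj
    obtain ⟨h1, h2⟩ := ih (by omega)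
    refine ⟨h2, ?_⟩
    have h3 := ((hp.isHarmonic_subdiv_iff L.len_root L.D X).1 hX).2.2 x j hj
    rw [legSequence_succ X hj, ← legSequence_of_le (p := p) X hj,
      ← legSequence_of_le (p := p) X (Nat.le_of_succ_le hj), h1, h2,
      smul_smul, L.rel x j hj, add_smul, add_comm] at h3
    exact (add_right_cancel h3).symm

theorem top_eq {x : V} (hA : X (base len x) = L.F x 0 • legValue p X x) :
    X (SubdivVertex.top len x) = L.F x (len x) • legValue p X x := by
  rw [← (L.legSequence_eq hp hX hA (len x) le_rfl).1, legSequence_of_le X le_rfl]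

theorem parent_eq {x : V} (hA : X (base len x) = L.F x 0 • legValue p X x) :
    X (base len (p x)) = L.F x (len x + 1) • legValue p X x := by
  rw [← (L.legSequence_eq hp hX hA (len x) le_rfl).2, legSequence_end]

/-- The relations at a branching point in terms of the values at index `1` of the legs. -/
theorem branching_eq {x : V} (hx : x ≠ ρ) (hch : ∃ y, y ≠ ρ ∧ p y = x)
    (hA : ∀ y, y ≠ ρ → p y = x → X (base len y) = L.F y 0 • legValue p X y) :
    X (base len x) = L.R • legValue p X (L.s x) ∧
    (∀ y, L.Ord y → p y = x → L.α y • legValue p X y = X (base len x)) ∧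
    legValue p X (L.s x) = legValue p X x +
      ∑ y with (y ≠ ρ ∧ p y = x) ∧ L.Ord y, L.legGenerator X y := by
  obtain ⟨h1, h2, h3, h4, h5⟩ := L.special x hx hch
  have hspec : X (base len x) = L.R • legValue p X (L.s x) := by
    have := L.parent_eq hp hX (hA _ h1 h2)
    rwa [h2, h4] at this
  refine ⟨hspec, fun y ho hy => ?_, ?_⟩
  · obtain ⟨h6, h7, h8, h9, h10⟩ := L.ord y ho
    have := L.parent_eq hp hX (hA _ h6 hy)
    rw [h8, h9, hy, natCast_zsmul] at this
    exact this.symm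
  · have hH := ((hp.isHarmonic_subdiv_iff L.len_root L.D X).1 hX).2.1 x hx
    rw [L.sum_children hx hch, L.top_eq hp hX (hA _ h1 h2)] at hH
    have hord : ∑ y with (y ≠ ρ ∧ p y = x) ∧ L.Ord y, X (SubdivVertex.top len y) =
        ∑ y with (y ≠ ρ ∧ p y = x) ∧ L.Ord y, L.legGenerator X y +
        (∑ y with (y ≠ ρ ∧ p y = x) ∧ L.Ord y, L.q y) • legValue p X (L.s x) := by
      rw [Finset.sum_smul, ← Finset.sum_add_distrib]
      refine Finset.sum_congr rfl fun y hy => ?_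
      simp only [Finset.mem_filter, Finset.mem_univ, true_and] at hy
      rw [L.top_eq hp hX (hA _ hy.1.1 hy.1.2), (L.ord y hy.2).2.2.1, L.F_one, one_smul,
        legGenerator, if_pos hy.2, hy.1.2, sub_add_cancel]
    have hsing : ∑ y with (y ≠ ρ ∧ p y = x) ∧ len y = 0, X (SubdivVertex.top len y) =
        (∑ y with (y ≠ ρ ∧ p y = x) ∧ len y = 0, L.F y 0) • X (base len x) := by
      rw [Finset.sum_smul]
      refine Finset.sum_congr rfl fun y hy => ?_
      simp only [Finset.mem_filter, Finset.mem_univ, true_and] at hy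
      rw [L.top_eq hp hX (hA _ hy.1.1 hy.1.2), hy.2, legValue_of_len_eq_zero X hy.2, hy.1.2]
    have hc := congrArg (· • legValue p X (L.s x)) (L.centre x hx hch)
    simp only [mul_smul, ← hspec, sub_smul, add_smul, one_smul, sub_eq_iff_eq_add] at hc
    rw [hord, hsing, hc] at hH
    rw [show X (subdivParent p len (base len x)) = legValue p X x from rfl] at hH
    have : legValue p X (L.s x) + (L.F (L.s x) (len (L.s x)) • legValue p X (L.s x) +
        (∑ y with (y ≠ ρ ∧ p y = x) ∧ L.Ord y, L.q y) • legValue p X (L.s x) +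
        (∑ y with (y ≠ ρ ∧ p y = x) ∧ len y = 0, L.F y 0) • X (base len x)) =
        legValue p X x + ∑ y with (y ≠ ρ ∧ p y = x) ∧ L.Ord y, L.legGenerator X y +
        (L.F (L.s x) (len (L.s x)) • legValue p X (L.s x) +
        (∑ y with (y ≠ ρ ∧ p y = x) ∧ L.Ord y, L.q y) • legValue p X (L.s x) +
        (∑ y with (y ≠ ρ ∧ p y = x) ∧ len y = 0, L.F y 0) • X (base len x)) := by
      rw [← sub_eq_zero] at hH ⊢
      rw [← hH]
      abel
    exact add_right_cancel this

/-- Proceed from the leaves to the root. At a leaf, `d = 1` makes the value equal to that of the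
neighbour. At an interior vertex the relation expresses `legValue p X x` as the special leg's value
minus generators, and multiplication by `R` kills these. -/
theorem base_eq (x : V) : x ≠ ρ → X (base len x) = L.F x 0 • legValue p X x := by
  refine hp.induction_up (P := fun x => x ≠ ρ → X (base len x) = L.F x 0 • legValue p X x)
    (fun x ih hx => ?_) x
  have ih' : ∀ y, y ≠ ρ → p y = x → X (base len y) = L.F y 0 • legValue p X y :=
    fun y hy hyx => ih y hy hyx hy
  by_cases hch : ∃ y, y ≠ ρ ∧ p y = x
  · obtain ⟨h1, h2, h3⟩ := L.branching_eq hp hX hx hch ih'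
    rw [L.nonleaf x hx hch, ← add_sub_cancel_right (legValue p X x)
      (∑ y with (y ≠ ρ ∧ p y = x) ∧ L.Ord y, L.legGenerator X y), ← h3, smul_sub, ← h1,
      Finset.smul_sum, Finset.sum_eq_zero, sub_zero]
    intro y hy
    simp only [Finset.mem_filter, Finset.mem_univ, true_and] at hy
    rw [legGenerator, if_pos hy.2, hy.1.2, ← L.q_mul y, smul_sub, mul_smul, natCast_zsmul,
      h2 y hy.2 hy.1.2, smul_smul, mul_comm, mul_smul, L.q_mul, ← h1, sub_self]
  · push Not at hch
    obtain ⟨h1, h2⟩ := L.leaf x hx hch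
    have hH := ((hp.isHarmonic_subdiv_iff L.len_root L.D X).1 hX).2.1 x hx
    have : ({y | y ≠ ρ ∧ p y = x} : Finset V) = ∅ := by
      ext y
      simpa using hch y
    rw [this, Finset.sum_empty, add_zero, h2, one_smul] at hH
    rw [h1, one_smul, hH]
    rfl

theorem smul_legGenerator (x : V) : L.α x • L.legGenerator X x = 0 := by
  rw [legGenerator]
  split_ifs with ho
  · obtain ⟨h1, h2, -⟩ := L.ord x ho
    obtain ⟨h3, h4, -⟩ := L.branching_eq hp hX h2 ⟨x, h1, rfl⟩ fun y hy _ => L.base_eq hp hX y hy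
    rw [smul_sub, h4 x ho rfl, ← natCast_zsmul, smul_smul, mul_comm, L.q_mul, ← h3, sub_self]
  · exact smul_zero _

/-- Every harmonic function satisfies the same recursion as the constructed ones; by
`IsSolution.unique` it is fixed by its root value and generators. -/
theorem isSolution_legValue :
    L.IsSolution (X (base len ρ)) (L.legGenerator X) (legValue p X) := by
  have hroot : legValue p X ρ = X (base len ρ) := by
    rw [legValue_of_len_eq_zero X L.len_root, hp.root]
  refine ⟨hroot, fun x hx => ?_⟩
  have hbr := fun hpx => L.branching_eq hp hX (x := p x) hpx ⟨x, hx, rfl⟩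
    fun y hy _ => L.base_eq hp hX y hy
  split_ifs with ho h0
  · obtain ⟨h1, h2, -⟩ := L.ord x ho
    rw [← (hbr h2).2.2, legGenerator, if_pos ho, sub_add_cancel]
  · rw [legValue_of_len_eq_zero X h0]
    by_cases hpx : p x = ρ
    · rw [hpx, hroot, L.F_root, one_smul]
    · exact L.base_eq hp hX _ hpx
  · have h1 : ¬ (p x = ρ ∨ x ≠ L.s (p x)) := fun hc => h0 (L.single x hx ho hc)
    push Not at h1
    rw [← (hbr h1.1).2.2, ← h1.2]

theorem extend_legValue : L.extend (legValue p X) = X := by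
  ext ⟨⟨x, j⟩, hj⟩
  rw [extend]
  by_cases hx : x = ρ
  · subst hx
    have hj : j ≤ len x := hj
    have h0 := L.len_root
    obtain rfl : j = 0 := by omega
    simp only
    rw [L.F_root, one_smul, (L.isSolution_legValue hp hX).1]
  · rw [← (L.legSequence_eq hp hX (L.base_eq hp hX x hx) j hj).1, legSequence_of_le]

end Harmonic

theorem solution_pos (hp : IsParent p ρ h) {τ : V → ℤ} (hτ : L.IsSolution 1 0 τ) (x : V) :
    0 < τ x := by
  refine hp.induction (P := fun x => 0 < τ x) (by rw [hτ.1]; exact one_pos) (fun x hx ih => ?_) x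
  rw [hτ.2 x hx]
  have hq : 0 < L.q x := by
    have h1 := L.q_mul x
    have h2 := L.R_pos
    rw [← h1] at h2
    exact pos_of_mul_pos_left h2 (Int.natCast_nonneg _)
  have hF := L.F_pos (p x) 0 (Nat.zero_le _)
  simp only [Pi.zero_apply, Finset.sum_const_zero, add_zero, zero_add, smul_eq_mul]
  split_ifs
  · exact mul_pos hq ih
  · exact mul_pos hF ih
  · exact ih

/-- Take the integer solution with root value 1 and no generators. Positivity of `r` forces `d` to
be nonnegative, and the entry 1 at the root makes `r` primitive. -/
theorem exists_arithmeticalStructure (hp : IsParent p ρ h) [Fintype (SubdivVertex len)]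
    [DecidableEq (SubdivVertex len)] :
    ∃ A : (parentGraph (subdivParent p len)).ArithmeticalStructure,
      A.d = fun w => L.D w.1.1 w.1.2 := by
  obtain ⟨τ, hτ⟩ := L.exists_isSolution hp (1 : ℤ) 0
  have hH := hτ.isHarmonic hp (fun x => by simp)
  have hpos : ∀ w, 0 < L.extend τ w := fun w =>
    mul_pos (L.F_pos _ _ (w.2.trans (Nat.le_succ _))) (L.solution_pos hp hτ _)
  refine ⟨⟨fun w => L.D w.1.1 w.1.2, L.extend τ, fun w => ?_, hpos, fun k hk => ?_, ?_⟩, rfl⟩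
  · have h1 := hH w
    rw [smul_eq_mul] at h1
    refine nonneg_of_mul_nonneg_left (b := L.extend τ w) ?_ (hpos w)
    rw [h1]
    exact Finset.sum_nonneg fun y _ => (hpos y).le
  · refine isUnit_of_dvd_one ?_
    have := hk (base len ρ)
    rwa [extend, L.F_root, one_smul, hτ.1] at this
  · ext w
    rw [genLaplacian_mulVec, Pi.zero_apply, sub_eq_zero]
    exact hH w

theorem nonempty_criticalGroup_equiv (hp : IsParent p ρ h) [Fintype (SubdivVertex len)]
    [DecidableEq (SubdivVertex len)]
    (A : (parentGraph (subdivParent p len)).ArithmeticalStructure)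
    (hA : A.d = fun w => L.D w.1.1 w.1.2) :
    Nonempty (A.CriticalGroup ≃+ ((x : V) → ZMod (L.α x))) := by
  have : ∀ x, NeZero (L.α x) := fun x => ⟨(L.α_pos x).ne'⟩
  -- Vertices outside `Ord` have `α = 1`, so their factor `ZMod 1` and their generator vanish.
  let e : V → ℤ × ((x : V) → ZMod (L.α x)) := fun x => (0, Pi.single x 1)
  have he : ∀ x, L.α x • e x = 0 := fun x => by
    ext y
    · simp [e]
    · simp only [e, Prod.smul_snd, Pi.smul_apply, Prod.snd_zero, Pi.zero_apply]
      by_cases hy : y = x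
      · subst hy; simp
      · simp [Pi.single_eq_of_ne hy]
  have he0 : ∀ x, ¬ L.Ord x → e x = 0 := fun x hx => by
    have h1 := he x
    rwa [L.α_eq_one x hx, one_smul] at h1
  obtain ⟨τ, hτ⟩ := L.exists_isSolution hp ((1, 0) : ℤ × ((x : V) → ZMod (L.α x))) e
  have hH := hτ.isHarmonic hp he
  set Y := fun w => (Submodule.Quotient.mk (Pi.single w 1) : (SubdivVertex len → ℤ) ⧸
    LinearMap.range ((parentGraph (subdivParent p len)).genLaplacian A.d).mulVecLin) with hYdef
  have hY : (parentGraph (subdivParent p len)).IsHarmonic (fun w => L.D w.1.1 w.1.2) Y := by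
    rw [← hA]
    exact isHarmonic_mk _ _
  -- The map sends the root coordinate and the cyclic generators to those of the tautological
  -- function; it is well defined by `smul_legGenerator`.
  let ψ : ℤ × ((x : V) → ZMod (L.α x)) →+ ((SubdivVertex len → ℤ) ⧸
      LinearMap.range ((parentGraph (subdivParent p len)).genLaplacian A.d).mulVecLin) :=
    AddMonoidHom.coprod (zmultiplesHom _ (Y (base len ρ)))
      (∑ x, (ZMod.lift (L.α x) ⟨zmultiplesHom _ (L.legGenerator Y x), by
        simpa using L.smul_legGenerator hp hY x⟩).comp (Pi.evalAddMonoidHom _ x))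
  have hψ0 : ψ (1, 0) = Y (base len ρ) := by
    simp [ψ, -map_sum]
  have hψe : (fun x => ψ (e x)) = L.legGenerator Y := by
    ext x
    simp only [ψ, e, AddMonoidHom.coprod_apply, map_zero, zero_add, AddMonoidHom.finsetSum_apply,
      AddMonoidHom.comp_apply, Pi.evalAddMonoidHom_apply]
    rw [Finset.sum_eq_single x]
    · rw [Pi.single_eq_same, ← Int.cast_one, ZMod.lift_coe]
      simp
    · intro y _ hy
      rw [Pi.single_eq_of_ne hy, map_zero]
    · simp
  -- Both sides solve the same recursion with the same data.
  have hψτ : (fun x => ψ (τ x)) = legValue p Y := by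
    have h1 := hτ.map ψ
    rw [hψ0, hψe] at h1
    exact IsSolution.unique L hp h1 (L.isSolution_legValue hp hY)
  refine A.nonempty_criticalGroup_equiv (X := L.extend τ) (hA ▸ hH) ?_ ψ fun w => ?_
  · rw [eq_top_iff]
    set S := Submodule.span ℤ (Set.range (L.extend τ)) with hS
    have hX : ∀ w, L.extend τ w ∈ S := fun w => Submodule.subset_span ⟨w, rfl⟩
    have h0 : ((1, 0) : ℤ × ((x : V) → ZMod (L.α x))) ∈ S := by
      have := hX (base len ρ)
      rwa [extend, L.F_root, one_smul, hτ.1] at this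
    have hτS : ∀ x, x ≠ ρ → τ x ∈ S := fun x hx => by
      have h1 := hX (subdivParent p len (base len x))
      rwa [hτ.extend_parent he hx (Nat.zero_le _), zero_add, L.F_one, one_smul] at h1
    -- Each cyclic generator is the difference of a leg value and a multiple of the special leg
    -- value.
    have heS : ∀ x, e x ∈ S := fun x => by
      by_cases ho : L.Ord x
      · obtain ⟨h1, h2, -⟩ := L.ord x ho
        have h3 := L.special (p x) h2 ⟨x, h1, rfl⟩
        rw [eq_sub_of_add_eq (hτ.ord ho).symm]
        exact S.sub_mem (hτS x h1) (S.smul_mem _ (hτS _ h3.1))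
      · rw [he0 x ho]
        exact S.zero_mem
    rintro ⟨n, k⟩ -
    have : ((n, k) : ℤ × ((x : V) → ZMod (L.α x))) =
        n • (1, 0) + ∑ x, ((k x).val : ℤ) • e x := by
      ext y
      · simp [e, Prod.fst_sum]
      · simp only [e, Prod.snd_add, Prod.smul_snd, smul_zero, zero_add, Prod.snd_sum,
          Finset.sum_apply, Pi.smul_apply]
        rw [Finset.sum_eq_single y]
        · simp
        · intro x _ hx
          rw [Pi.single_eq_of_ne hx.symm, smul_zero]
        · simp
    rw [this]
    exact S.add_mem (S.smul_mem _ h0) (S.sum_mem fun x _ => S.smul_mem _ (heS x))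
  · rw [extend, map_zsmul]
    have h1 : ψ (τ w.1.1) = _ := congrFun hψτ w.1.1
    rw [h1]
    exact congrFun (L.extend_legValue hp hY) w

end LegData

end Legs

end SimpleGraph

/-! ### Division sequences and existence of leg data. -/

/-- Division with negative remainders, read backwards: two coprime positive integers `b`, `R` are
the last two terms of a sequence of positive integers starting with `a, 1`, in which each inner
term divides the sum of its neighbours. -/
theorem exists_division_sequence {a : ℤ} (ha : 0 < a) (b : ℕ) :
    ∀ R : ℤ, 0 < R → 0 < b → IsCoprime R b → ∃ (n : ℕ) (f D : ℕ → ℤ), 1 ≤ n ∧ f 0 = a ∧ f 1 = 1 ∧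
      f n = b ∧ f (n + 1) = R ∧ (∀ j, j ≤ n + 1 → 0 < f j) ∧
      ∀ j, j + 1 ≤ n → D (j + 1) * f (j + 1) = f j + f (j + 2) := by
  induction b using Nat.strong_induction_on with
  | _ b ih =>
    intro R hR hb hc
    by_cases h1 : b = 1
    · subst h1
      refine ⟨1, fun j => if j = 0 then a else if j = 1 then 1 else R, fun _ => a + R, le_rfl,
        rfl, rfl, rfl, rfl, fun j _ => ?_, fun j hj => ?_⟩
      · simp only
        split_ifs
        · exact ha
        · exact one_pos
        · exact hR
      · obtain rfl : j = 0 := by omega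
        simp
    · have hb0 : (b : ℤ) ≠ 0 := by exact_mod_cast hb.ne'
      -- The term before `b` is the residue of `-R`, so that `b` divides the sum of its neighbours.
      -- It is nonzero because `b ≠ 1` is coprime to `R`, and the recursion descends to 1; the first
      -- term `a` is attached only at the end and is therefore free.
      set c := (-R) % (b : ℤ) with hcdef
      have hc0 : 0 ≤ c := Int.emod_nonneg _ hb0
      have hcb : c < b := Int.emod_lt_of_pos _ (by exact_mod_cast hb)
      have hdiv : c + (b : ℤ) * (-R / b) = -R := Int.emod_add_mul_ediv _ _
      have hcop : IsCoprime (b : ℤ) c := by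
        have h2 : c = -R + b * (-(-R / b)) := by linarith
        rw [h2]
        exact IsCoprime.add_mul_left_right hc.symm.neg_right _
      have hcne : c ≠ 0 := by
        intro h0
        rw [h0, isCoprime_zero_right, Int.isUnit_iff] at hcop
        omega
      obtain ⟨m, hm⟩ := Int.eq_ofNat_of_zero_le hc0
      obtain ⟨n, f, D, hn, hf0, hf1, hfn, hfn1, hpos, hrel⟩ :=
        ih m (by omega) b (by exact_mod_cast hb) (by omega) (hm ▸ hcop)
      refine ⟨n + 1, fun j => if j = n + 2 then R else f j,
        fun j => if j = n + 1 then -(-R / b) else D j, by omega, ?_, ?_, ?_, ?_, ?_, ?_⟩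
      · simp [hf0]
      · simp only
        rw [if_neg (by omega), hf1]
      · simp [hfn1]
      · simp
      · intro j hj
        simp only
        split_ifs with h
        · exact hR
        · exact hpos j (by omega)
      · intro j hj
        simp only
        rw [if_neg (show j + 1 ≠ n + 2 by omega), if_neg (show j ≠ n + 2 by omega)]
        by_cases hjn : j = n
        · subst hjn
          rw [if_pos rfl, if_pos rfl, hfn, hfn1, ← hm]
          linarith
        · rw [if_neg (by omega), if_neg (by omega)]
          exact hrel j (by omega)

namespace SimpleGraph

section Legs

open scoped Classical

variable {V : Type u} [Fintype V]

/-- Leg data exist for prescribed orders of the cyclic factors, prescribed special legs, and a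
prescribed set of edges that are not to be subdivided. -/
theorem exists_legData (p : V → V) (ρ : V) (M : V → Prop) (s : V → V)
    (hs : ∀ x, x ≠ ρ → (∃ y, y ≠ ρ ∧ p y = x) → s x ≠ ρ ∧ p (s x) = x ∧ ¬ M (s x))
    (α : V → ℕ) (hα : ∀ x, 0 < α x)
    (hα1 : ∀ x, ¬ (x ≠ ρ ∧ p x ≠ ρ ∧ ¬ M x ∧ x ≠ s (p x)) → α x = 1) :
    ∃ (len : V → ℕ) (L : LegData p ρ len), L.α = α ∧
      ∀ x, x ≠ ρ → (len x = 0 ↔ M x ∨ p x = ρ) := by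
  set Ord : V → Prop := fun x => x ≠ ρ ∧ p x ≠ ρ ∧ ¬ M x ∧ x ≠ s (p x) with hOrd
  set Z : V → Prop := fun x => x = ρ ∨ M x ∨ p x = ρ with hZ
  set nl : V → Prop := fun x => x ≠ ρ ∧ ∃ y, y ≠ ρ ∧ p y = x with hnl
  set N : ℤ := ∏ x, (α x : ℤ) with hN
  have hNpos : 0 < N := Finset.prod_pos fun x _ => by exact_mod_cast hα x
  have hdvd : ∀ x, (α x : ℤ) ∣ N := fun x => Finset.dvd_prod_of_mem _ (Finset.mem_univ x)
  choose c hc using hdvd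
  have hcpos : ∀ x, 0 < c x := fun x => by
    have h1 : 0 < (α x : ℤ) * c x := hc x ▸ hNpos
    exact pos_of_mul_pos_right h1 (by positivity)
  -- The square makes every `q x = R / α x = N * c x` a multiple of `N`, so that `1 + ∑ q` is
  -- coprime to `R`.
  set R : ℤ := N ^ 2 with hR
  have hRpos : 0 < R := by positivity
  set F0 : V → ℤ := fun x => if nl x then R else 1 with hF0
  have hF0pos : ∀ x, 0 < F0 x := fun x => by
    simp only [hF0]
    split_ifs
    · exact hRpos
    · exact one_pos
  set σ' : V → ℤ := fun x => ∑ y with (y ≠ ρ ∧ p y = x) ∧ Ord y, c y with hσ'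
  have hσ'pos : ∀ x, 0 ≤ σ' x := fun x => Finset.sum_nonneg fun y _ => (hcpos y).le
  -- This solves the equation `centre` with `D x 0`, less the single-edge terms, equal to `∑ q + 2`.
  -- The coefficient `∑ q + 1` would give `b = 0` when `R = 1`.
  set b : V → ℤ := fun x => (N * σ' x + 2) * R - (N * σ' x + 1) with hb
  have hbpos : ∀ x, 0 < b x := fun x => by
    have h1 : 0 ≤ N * σ' x := mul_nonneg hNpos.le (hσ'pos x)
    have h2 : (N * σ' x + 2) * 1 ≤ (N * σ' x + 2) * R :=
      mul_le_mul_of_nonneg_left (by omega) (by omega)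
    simp only [hb]
    omega
  have hcop : ∀ x, IsCoprime R (b x) := fun x => by
    refine IsCoprime.pow_left ⟨(N * σ' x + 2) * N - σ' x, -1, ?_⟩
    simp only [hb, hR]
    ring
  have hchain := fun x => exists_division_sequence (hF0pos x) (b (p x)).toNat R hRpos
    (by have := hbpos (p x); omega)
    (by rw [Int.toNat_of_nonneg (hbpos (p x)).le]; exact hcop (p x))
  choose n f D hn hf0 hf1 hfn hfn1 hfpos hfrel using hchain
  simp only [Int.toNat_of_nonneg (hbpos _).le] at hfn
  -- A special leg is as long as its division sequence requires; the other subdivided legs get one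
  -- new vertex each, even when their factor is trivial.
  set len : V → ℕ := fun x => if Z x then 0 else if x = s (p x) then n x else 1 with hlen
  have hlenZ : ∀ x, Z x → len x = 0 := fun x hx => if_pos hx
  have hlenS : ∀ x, ¬ Z x → x = s (p x) → len x = n x := fun x h1 h2 => by
    simp only [hlen]
    rw [if_neg h1, if_pos h2]
  have hlenO : ∀ x, ¬ Z x → x ≠ s (p x) → len x = 1 := fun x h1 h2 => by
    simp only [hlen]
    rw [if_neg h1, if_neg h2]
  set F : V → ℕ → ℤ := fun x j => if j = 0 then F0 x else if j = 1 then 1 else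
    if x = s (p x) then f x j else α x with hF
  have hFs : ∀ x, x = s (p x) → F x = f x := fun x hx => by
    ext j
    simp only [hF]
    rw [if_pos hx]
    split_ifs with h1 h2
    · rw [h1, hf0]
    · rw [h2, hf1]
    · rfl
  have hsZ : ∀ x, nl x → ¬ Z (s x) ∧ s x = s (p (s x)) := fun x hx => by
    obtain ⟨h1, h2, h3⟩ := hs x hx.1 hx.2
    refine ⟨?_, by rw [h2]⟩
    rintro (h | h | h)
    · exact h1 h
    · exact h3 h
    · exact hx.1 (h2.symm.trans h)
  have hordZ : ∀ x, Ord x → ¬ Z x := by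
    rintro x ⟨h1, h2, h3, -⟩ (h | h | h)
    · exact h1 h
    · exact h3 h
    · exact h2 h
  refine ⟨len, ?_, ?_⟩
  · exact {
      F := F
      D := fun x j => if j = 0 then
          (if x = ρ then ∑ y with y ≠ ρ ∧ p y = ρ, F y 0
          else if nl x then (N * σ' x + 2) + ∑ y with (y ≠ ρ ∧ p y = x) ∧ len y = 0, F y 0
          else 1)
        else if x = s (p x) then D x j else F0 x + α x
      α := α
      q := fun x => N * c x
      R := R
      s := s
      Ord := Ord
      len_root := hlenZ ρ (Or.inl rfl)
      F_pos := fun x j hj => by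
        by_cases hx : x = s (p x)
        · by_cases hz : Z x
          · rw [hlenZ x hz] at hj
            simp only [hF]
            split_ifs
            · exact hF0pos x
            · exact one_pos
            · omega
          · rw [hFs x hx]
            exact hfpos x j (hlenS x hz hx ▸ hj)
        · simp only [hF]
          split_ifs
          · exact hF0pos x
          · exact one_pos
          · exact_mod_cast hα x
      F_one := fun x => by simp [hF]
      F_root := by simp [hF, hF0, hnl]
      rel := fun x j hj => by
        have hz : ¬ Z x := fun hz => by
          rw [hlenZ x hz] at hj
          omega
        rw [if_neg (Nat.succ_ne_zero j)]
        by_cases hx : x = s (p x)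
        · rw [if_pos hx, hFs x hx]
          exact hfrel x j (hlenS x hz hx ▸ hj)
        · rw [if_neg hx]
          rw [hlenO x hz hx] at hj
          obtain rfl : j = 0 := by omega
          simp [hF, hx]
      leaf := fun x hx hch => by
        have : ¬ nl x := fun h => by
          obtain ⟨-, y, h1, h2⟩ := h
          exact hch y h1 h2
        simp [hF, hF0, this, hx]
      nonleaf := fun x hx hch => by
        have : nl x := ⟨hx, hch⟩
        simp [hF, hF0, this]
      R_pos := hRpos
      special := fun x hx hch => by
        obtain ⟨h1, h2⟩ := hsZ x ⟨hx, hch⟩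
        obtain ⟨h3, h4, h5⟩ := hs x hx hch
        rw [hFs _ h2, hlenS _ h1 h2]
        exact ⟨h3, h4, fun ho => ho.2.2.2 h2, hfn1 _, hn _⟩
      ord := fun x hx => by
        refine ⟨hx.1, hx.2.1, hlenO x (hordZ x hx) hx.2.2.2, ?_, hx.2.2.2⟩
        simp [hF, hx.2.2.2]
      α_pos := hα
      q_mul := fun x => by
        rw [mul_assoc, mul_comm (c x), ← hc x, hR, pow_two]
      α_eq_one := hα1
      single := fun x hx ho hxs => by
        refine hlenZ x ?_
        by_contra hz
        rcases hxs with h | h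
        · exact hz (Or.inr (Or.inr h))
        · exact ho ⟨hx, fun e => hz (Or.inr (Or.inr e)), fun e => hz (Or.inr (Or.inl e)), h⟩
      centre := fun x hx hch => by
        obtain ⟨h1, h2⟩ := hsZ x ⟨hx, hch⟩
        rw [hFs _ h2, hlenS _ h1 h2, hfn, (hs x hx hch).2.1, if_pos rfl, if_neg hx,
          if_pos (show nl x from ⟨hx, hch⟩), add_sub_cancel_right, ← Finset.mul_sum]
        have hsum : (N * σ' x + 2) * R = 1 + b x + N * σ' x := by
          simp only [hb]
          ring
        convert hsum
      D_root := by simp }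
  · refine ⟨rfl, fun x hx => ⟨fun h0 => ?_, fun h => hlenZ x (Or.inr h)⟩⟩
    by_contra hz
    have hz' : ¬ Z x := fun h => hz (h.resolve_left hx)
    by_cases hxs : x = s (p x)
    · have := hn x
      rw [hlenS x hz' hxs] at h0
      omega
    · rw [hlenO x hz' hxs] at h0
      omega

end Legs

/-! ### Transport along isomorphisms. -/

section Iso

variable {V : Type u} {W : Type v} {G : SimpleGraph V} {H : SimpleGraph W} (e : G ≃g H)
include e

theorem vdeg_iso (x : V) : H.vdeg (e x) = G.vdeg x := by
  rw [vdeg, vdeg, ← Set.ncard_image_of_injective _ e.injective]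
  congr 1
  ext y
  obtain ⟨z, rfl⟩ := e.surjective y
  simpa [e.injective.eq_iff] using e.map_adj_iff

theorem leafNumber_iso : H.leafNumber = G.leafNumber := by
  rw [leafNumber, leafNumber, ← Set.ncard_image_of_injective _ e.injective]
  congr 1
  ext y
  obtain ⟨z, rfl⟩ := e.surjective y
  simp [vdeg_iso e, e.injective.eq_iff]

theorem IsSparse.map_iso {M : Set (Sym2 V)} (hM : G.IsSparse M) :
    H.IsSparse (Sym2.map e '' M) := by
  refine ⟨?_, fun y => ?_⟩
  · rintro _ ⟨d, hd, rfl⟩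
    have := hM.1 hd
    induction d with | _ x y
    exact e.map_adj_iff.2 this
  · obtain ⟨x, rfl⟩ := e.surjective y
    rw [vdeg_iso e]
    refine le_trans (le_of_eq ?_) (hM.2 x)
    rw [← Set.ncard_image_of_injective {d ∈ M | x ∈ d} (Sym2.map.injective e.injective)]
    congr 1
    ext d
    constructor
    · rintro ⟨⟨d, hd, rfl⟩, hb⟩
      obtain ⟨b', hb', hj⟩ := Sym2.mem_map.1 hb
      exact ⟨d, ⟨hd, e.injective hj ▸ hb'⟩, rfl⟩
    · rintro ⟨d, ⟨hd, hb⟩, rfl⟩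
      exact ⟨⟨d, hd, rfl⟩, Sym2.mem_map.2 ⟨x, hb, rfl⟩⟩

theorem ncard_map_iso (M : Set (Sym2 V)) : (Sym2.map e '' M).ncard = M.ncard :=
  Set.ncard_image_of_injective _ (Sym2.map.injective e.injective)

theorem HasMaxSparse.map_iso {m : ℕ} (hm : G.HasMaxSparse m) : H.HasMaxSparse m := by
  obtain ⟨⟨M, hM, hcard⟩, hmax⟩ := hm
  refine ⟨⟨_, hM.map_iso e, (ncard_map_iso e M).trans hcard⟩, fun N hN => ?_⟩
  rw [← ncard_map_iso e.symm N]
  exact hmax _ (hN.map_iso e.symm)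

/-- Transport of an arithmetical structure along an isomorphism. -/
theorem ArithmeticalStructure.exists_map_iso [Fintype V] [DecidableEq V] [Fintype W]
    [DecidableEq W] (A : G.ArithmeticalStructure) :
    ∃ B : H.ArithmeticalStructure, Nonempty (B.CriticalGroup ≃+ A.CriticalGroup) := by
  have hL : ∀ v : W → ℤ, (H.genLaplacian fun y => A.d (e.symm y)).mulVec v =
      fun y => (G.genLaplacian A.d).mulVec (fun x => v (e x)) (e.symm y) := by
    intro v
    ext y
    rw [genLaplacian_mulVec, genLaplacian_mulVec]
    simp only [RelIso.apply_symm_apply]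
    congr 1
    refine Finset.sum_equiv e.symm.toEquiv (fun z => ?_) (fun z _ => by simp)
    simpa using e.symm.map_adj_iff.symm
  refine ⟨⟨fun y => A.d (e.symm y), fun y => A.r (e.symm y), fun y => A.d_nonneg _,
    fun y => A.r_pos _, fun k hk => A.r_primitive k fun x => ?_, ?_⟩, ?_⟩
  · have := hk (e x)
    rwa [RelIso.symm_apply_apply] at this
  · rw [hL]
    ext y
    simp only [RelIso.symm_apply_apply]
    exact congrFun A.laplacian_mulVec _
  · let f : (W → ℤ) ≃ₗ[ℤ] (V → ℤ) := LinearEquiv.funCongrLeft ℤ ℤ e.toEquiv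
    have hf : ∀ v x, f v x = v (e x) := fun v x => rfl
    have hrange : Submodule.map (f : (W → ℤ) →ₗ[ℤ] (V → ℤ))
        (LinearMap.range (H.genLaplacian fun y => A.d (e.symm y)).mulVecLin) =
        LinearMap.range (G.genLaplacian A.d).mulVecLin := by
      ext v
      constructor
      · rintro ⟨_, ⟨v, rfl⟩, rfl⟩
        refine ⟨f v, ?_⟩
        ext x
        simp only [Matrix.mulVecLin_apply, LinearEquiv.coe_coe, hL, hf, RelIso.symm_apply_apply]
        rfl
      · rintro ⟨v, rfl⟩
        refine ⟨_, ⟨f.symm v, rfl⟩, ?_⟩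
        ext x
        simp only [Matrix.mulVecLin_apply, LinearEquiv.coe_coe, hL, hf, RelIso.symm_apply_apply]
        congr 2
        exact f.apply_symm_apply v
    let g := Submodule.Quotient.equiv _ _ f hrange
    refine ⟨((g.ofSubmodules _ _ ?_).toAddEquiv)⟩
    ext q
    constructor
    · rintro ⟨q, hq, rfl⟩
      obtain ⟨a, ha⟩ := hq
      exact ⟨a, (map_smul g (a : ℤ) q).symm.trans ((congrArg g ha).trans (map_zero g))⟩
    · rintro ⟨a, ha⟩
      exact ⟨g.symm q, ⟨a, (map_smul g.symm (a : ℤ) q).symm.trans ((congrArg g.symm ha).trans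
        (map_zero g.symm))⟩, g.apply_symm_apply q⟩

end Iso

/-! ### Counting the free legs, and conclusion. -/

namespace IsParent

variable {V : Type u} [Finite V] {p : V → V} {ρ : V} {h : V → ℕ} (hp : IsParent p ρ h)
include hp

/-- Every branching point has a child not joined to it by an edge of a given sparse set. -/
theorem exists_child_notMem {M : Set (Sym2 V)} (hM : (parentGraph p).IsSparse M) {x : V}
    (hx : x ≠ ρ) (hch : ∃ y, y ≠ ρ ∧ p y = x) : ∃ y, y ≠ ρ ∧ p y = x ∧ s(y, p y) ∉ M := by
  by_contra! hcon
  -- A non-root vertex has `deg - 1` children, while `M` contains at most `deg - 2` edges there.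
  have h1 := hM.2 x
  have h2 := hp.vdeg_of_ne hx
  have h3 : {y | y ≠ ρ ∧ p y = x}.ncard ≤ {e ∈ M | x ∈ e}.ncard := by
    rw [← (hp.injOn_edge.mono (s₁ := {y | y ≠ ρ ∧ p y = x}) fun y hy => hy.1).ncard_image]
    refine Set.ncard_le_ncard ?_
    rintro _ ⟨y, ⟨hy, hyx⟩, rfl⟩
    refine ⟨hcon y hy hyx, ?_⟩
    simp [hyx]
  have h4 : 0 < {y | y ≠ ρ ∧ p y = x}.ncard := (Set.ncard_pos (Set.toFinite _)).2 hch
  omega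

/-- The number of legs that may carry a cyclic factor. -/
theorem leafNumber_le {M : Set (Sym2 V)} (hρ : (parentGraph p).vdeg ρ = 1) (s : V → V) :
    (parentGraph p).leafNumber ≤ M.ncard + 2 +
      {x | x ≠ ρ ∧ p x ≠ ρ ∧ s(x, p x) ∉ M ∧ x ≠ s (p x)}.ncard := by
  set O := {x | x ≠ ρ ∧ p x ≠ ρ ∧ s(x, p x) ∉ M ∧ x ≠ s (p x)} with hO
  set C := {x | x ≠ ρ ∧ p x = ρ} with hC
  set E := {x | x ≠ ρ ∧ s(x, p x) ∈ M} with hE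
  set S := {x | x ≠ ρ ∧ p x ≠ ρ ∧ x = s (p x)} with hS
  set I := {x | (parentGraph p).vdeg x ≠ 1} with hI
  have h1 : C.ncard = 1 := by rw [← hρ, hp.vdeg_root]
  have h2 : E.ncard ≤ M.ncard := by
    rw [← (hp.injOn_edge.mono (s₁ := E) fun y hy => hy.1).ncard_image]
    refine Set.ncard_le_ncard ?_
    rintro _ ⟨x, ⟨-, hx⟩, rfl⟩
    exact hx
  -- There is at most one special leg for each vertex that is not a leaf.
  have h3 : S.ncard ≤ I.ncard := by
    have hinj : Set.InjOn p S := fun x hx y hy hxy => by rw [hx.2.2, hy.2.2, hxy]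
    rw [← hinj.ncard_image]
    refine Set.ncard_le_ncard ?_
    rintro _ ⟨x, ⟨hx, hpx, -⟩, rfl⟩ h1
    rw [hp.vdeg_of_ne hpx] at h1
    have : 0 < {y | y ≠ ρ ∧ p y = p x}.ncard := (Set.ncard_pos (Set.toFinite _)).2 ⟨x, hx, rfl⟩
    omega
  have h4 : (parentGraph p).leafNumber + I.ncard = Nat.card V :=
    Set.ncard_add_ncard_compl {x | (parentGraph p).vdeg x = 1}
  -- Each non-root vertex lies below the root, on an edge of `M`, on a special leg, or on a free
  -- leg. Counting vertices as leaves plus non-leaves then cancels the special legs.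
  have h5 : (Set.univ : Set V) ⊆ insert ρ (C ∪ (E ∪ (S ∪ O))) := by
    intro x _
    by_cases hx : x = ρ
    · exact Or.inl hx
    by_cases hc : p x = ρ
    · exact Or.inr (Or.inl ⟨hx, hc⟩)
    by_cases hm : s(x, p x) ∈ M
    · exact Or.inr (Or.inr (Or.inl ⟨hx, hm⟩))
    by_cases hs : x = s (p x)
    · exact Or.inr (Or.inr (Or.inr (Or.inl ⟨hx, hc, hs⟩)))
    · exact Or.inr (Or.inr (Or.inr (Or.inr ⟨hx, hc, hm, hs⟩)))
  have h6 := Set.ncard_le_ncard h5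
  rw [Set.ncard_univ] at h6
  have h7 := Set.ncard_insert_le ρ (C ∪ (E ∪ (S ∪ O)))
  have h8 := Set.ncard_union_le C (E ∪ (S ∪ O))
  have h9 := Set.ncard_union_le E (S ∪ O)
  have h10 := Set.ncard_union_le S O
  omega

end IsParent

/-- A finite product of cyclic groups, extended by trivial factors. -/
theorem nonempty_pi_zmod_extend_equiv {ι : Type u} {V : Type v} (j : ι ↪ V) (α : ι → ℕ) :
    Nonempty (((x : V) → ZMod (Function.extend j α 1 x)) ≃+ ((i : ι) → ZMod (α i))) := by
  suffices ∀ (a : V → ℕ) (α : ι → ℕ), α = (fun i => a (j i)) →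
      (∀ x, (¬ ∃ i, j i = x) → a x = 1) →
      Nonempty (((x : V) → ZMod (a x)) ≃+ ((i : ι) → ZMod (α i))) from
    this _ α (funext fun i => (j.injective.extend_apply α 1 i).symm)
      fun x hx => Function.extend_apply' _ _ _ hx
  rintro a _ rfl ha
  let f : ((x : V) → ZMod (a x)) →+ ((i : ι) → ZMod (a (j i))) :=
    { toFun := fun z i => z (j i)
      map_zero' := rfl
      map_add' := fun _ _ => rfl }
  have hsub : ∀ x, (¬ ∃ i, j i = x) → Subsingleton (ZMod (a x)) := fun x hx => by
    rw [ha x hx]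
    infer_instance
  refine ⟨AddEquiv.ofBijective f ⟨fun z z' hz => ?_, fun z => ?_⟩⟩
  · ext x
    by_cases hx : ∃ i, j i = x
    · obtain ⟨i, rfl⟩ := hx
      exact congrFun hz i
    · exact (hsub x hx).elim _ _
  · classical
    -- The chosen preimage equals the given index only propositionally, so the value must be
    -- transported.
    have key : ∀ (i i' : ι) (hi : j i' = j i), (hi ▸ z i' : ZMod (a (j i))) = z i := by
      intro i i' hi
      obtain rfl := j.injective hi
      rfl
    refine ⟨fun x => if hx : ∃ i, j i = x then hx.choose_spec ▸ z hx.choose else 0,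
      funext fun i => ?_⟩
    have hx : ∃ i', j i' = j i := ⟨i, rfl⟩
    change dite _ _ _ = _
    rw [dif_pos hx]
    exact key i _ hx.choose_spec

/-- The construction on the subdivided tree itself. -/
theorem exists_subdivision_criticalGroup {U : Type u} {G : SimpleGraph U} {V : Type v} [Finite V]
    {T : SimpleGraph V} (hT : T.IsTree) (hG : G.IsSubdivision T) {M : Set (Sym2 V)}
    (hM : T.IsSparse M) {k : ℕ} (α : Fin k → ℕ) (hα : ∀ i, 0 < α i)
    (hk : k + 2 + M.ncard ≤ T.leafNumber) :
    ∃ (W : Type v) (_ : Fintype W) (_ : DecidableEq W) (H : SimpleGraph W), H.IsTree ∧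
      G.IsSubdivision H ∧ H.HasMaxSparse M.ncard ∧
      ∃ A : H.ArithmeticalStructure, Nonempty (A.CriticalGroup ≃+ ((i : Fin k) → ZMod (α i))) := by
  classical
  have := Fintype.ofFinite V
  -- The leaf bound provides a leaf to serve as root.
  obtain ⟨ρ, hρ⟩ : {x : V | T.vdeg x = 1}.Nonempty := by
    rw [← Set.ncard_pos (Set.toFinite _)]
    change 0 < T.leafNumber
    omega
  obtain ⟨p, h, hp, rfl⟩ := hT.exists_isParent ρ
  have hρ : (parentGraph p).vdeg ρ = 1 := hρ
  have H := fun x (hx : x ≠ ρ) hch => hp.exists_child_notMem hM hx hch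
  choose! s hs1 hs2 hs3 using H
  set O := {x | x ≠ ρ ∧ p x ≠ ρ ∧ s(x, p x) ∉ M ∧ x ≠ s (p x)} with hO
  have hcount := hp.leafNumber_le (M := M) hρ s
  rw [← hO] at hcount
  have hkO : Fintype.card (Fin k) ≤ Fintype.card O := by
    rw [Fintype.card_fin, ← Nat.card_eq_fintype_card, Nat.card_coe_set_eq]
    omega
  obtain ⟨j⟩ := Function.Embedding.nonempty_of_card_le hkO
  let j' : Fin k ↪ V := j.trans (Function.Embedding.subtype _)
  have hpos : ∀ x, 0 < Function.extend j' α 1 x := fun x => by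
    by_cases hx : ∃ i, j' i = x
    · obtain ⟨i, rfl⟩ := hx
      rw [j'.injective.extend_apply]
      exact hα i
    · rw [Function.extend_apply' _ _ _ hx]
      exact one_pos
  obtain ⟨len, L, hLα, hlen⟩ := exists_legData p ρ (fun x => s(x, p x) ∈ M) s
    (fun x hx hch => ⟨hs1 x hx hch, hs2 x hx hch, hs3 x hx hch⟩) (Function.extend j' α 1) hpos
    (fun x hx => Function.extend_apply' _ _ _ fun ⟨i, hi⟩ => hx (hi ▸ (j i).2))
  have : Fintype (SubdivVertex len) := Fintype.ofFinite _
  obtain ⟨h', hp'⟩ := hp.exists_subdiv L.len_root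
  obtain ⟨A, hA⟩ := L.exists_arithmeticalStructure hp
  obtain ⟨f⟩ := L.nonempty_criticalGroup_equiv hp A hA
  rw [hLα] at f
  obtain ⟨g⟩ := nonempty_pi_zmod_extend_equiv j' α
  exact ⟨SubdivVertex len, inferInstance, inferInstance, _, hp'.isTree,
    hp.isSubdivision L.len_root hG, hp.hasMaxSparse_subdiv L.len_root hM (by omega) hlen,
    A, ⟨f.trans g⟩⟩

end SimpleGraph

open SimpleGraph in
theorem theorem7p2 {V : Type u} [Finite V] (T : SimpleGraph V) (hT : T.IsTree)
    (β : ℕ) (hβ : β ≤ T.splittingIrregularity)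
    (𝒢 : Type v) [AddCommGroup 𝒢] [Finite 𝒢] (k : ℕ) (hk : HasInvariantFactorCount 𝒢 k)
    (hle : (k : ℤ) ≤ (T.leafNumber : ℤ) - 2 - (β : ℤ)) :
    ∃ (n : ℕ) (T' : SimpleGraph (Fin n)),
      T.IsSubdivision T' ∧ T'.splittingIrregularity = β ∧
      ∃ A : T'.ArithmeticalStructure, Nonempty (A.CriticalGroup ≃+ 𝒢) := by
  obtain ⟨α, hα, -, ⟨g⟩⟩ := hk
  obtain ⟨M₀, hM₀, hcard₀⟩ := T.exists_sparse_splittingIrregularity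
  obtain ⟨M, hMM, rfl⟩ := Set.exists_subset_card_eq (hcard₀ ▸ hβ : β ≤ M₀.ncard)
  have hM := hM₀.mono hMM
  -- Passing to `Fin m` first makes the subdivision live in `Type`, as the final relabelling by `Fin
  -- n` requires.
  obtain ⟨m, ⟨e₀⟩⟩ := Finite.exists_equiv_fin V
  let e : T ≃g T.map e₀.toEmbedding := Iso.map e₀ T
  obtain ⟨W, _, _, H, hH, hsub, hmax, A, ⟨f⟩⟩ := exists_subdivision_criticalGroup
    (e.isTree_iff.1 hT) (.of_iso e) (hM.map_iso e) α (fun i => zero_lt_one.trans (hα i))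
    (by rw [ncard_map_iso, leafNumber_iso e]; omega)
  rw [ncard_map_iso] at hmax
  let e₁ : H ≃g H.map (Fintype.equivFin W).toEmbedding := Iso.map (Fintype.equivFin W) H
  obtain ⟨B, ⟨f'⟩⟩ := A.exists_map_iso e₁
  exact ⟨_, _, hsub.trans_iso e₁, (e₁.isTree_iff.1 hH).splittingIrregularity_eq (hmax.map_iso e₁),
    B, ⟨(f'.trans f).trans g.symm⟩⟩
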